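/- Let $n\ge 1$ mobile agents be placed at points $0\le Pos[1]<Pos[2]<\dots<Pos[n]\le \ell$ of a line segment $[0,\ell]$, and let $a_k$ be any one of them, the source. All agents move at unit speed inside the segment. A strategy is a finite sequence of movements, in each of which one agent, starting at a specified time, walks between two points of the segment. Whenever two agents meet (are at the same point at the same time) they exchange all information they hold. A broadcast strategy is a strategy after which all agents hold the initial information of $a_k$. A strategy uses power at most $P$ if every agent travels a total distance of at most $P$. The optimal broadcast power $P^b_{OPT}$ is the smallest $P$ such that some broadcast strategy uses power at most $P$. There is an algorithm (a program for the unit-cost real RAM, with exact real arithmetic and comparisons) which, given $n$, $k$ and $Pos[1],\dots,Pos[n]$, computes in time $O(n)$ the optimal broadcast power $P^b_{OPT}$ and an optimal broadcast strategy, that is, an explicit list of movements forming a broadcast strategy that uses power at most $P^b_{OPT}$. The program and the constant in $O(n)$ do not depend on $n$, $k$, $\ell$ or the positions. -/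

import Mathlib

/-! ## Mobile agents on a line segment -/

namespace LineAgents

/-- `n` agents at pairwise distinct points of the segment `[0, ℓ]`, numbered from left to right. -/
def IsConfiguration {n : ℕ} (ℓ : ℝ) (pos : Fin n → ℝ) : Prop :=
  StrictMono pos ∧ ∀ i, pos i ∈ Set.Icc 0 ℓ

/-- One movement: `agent` leaves the point `src` at time `start` and walks, at unit speed,
straight to the point `dst`. -/
structure Move (n : ℕ) where
  agent : Fin n
  start : ℝ
  src : ℝ
  dst : ℝ

/-- The distance travelled in a movement, which is also its duration. -/
def Move.length {n : ℕ} (m : Move n) : ℝ := |m.dst - m.src|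

/-- A strategy is a finite sequence of movements of the agents. -/
abbrev Strategy (n : ℕ) := List (Move n)

/-- The movements of agent `i`, in their order in the sequence. -/
def Strategy.movesOf {n : ℕ} (S : Strategy n) (i : Fin n) : List (Move n) :=
  S.filter (fun m => decide (m.agent = i))

/-- Movements which a single agent, idle at the point `x` from time `t` on, can execute one after
the other inside `[0, ℓ]`: each one starts where the agent is, and not before the previous one
is finished. -/
def FeasibleFrom {n : ℕ} (ℓ : ℝ) : ℝ → ℝ → List (Move n) → Prop
  | _, _, [] => True
  | t, x, m :: L =>
      t ≤ m.start ∧ m.src = x ∧ m.dst ∈ Set.Icc 0 ℓ ∧ FeasibleFrom ℓ (m.start + m.length) m.dst L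

/-- The position at time `t` of an agent that is initially at `x` and executes the given
movements, being idle before, between and after them. -/
noncomputable def positionFrom {n : ℕ} : ℝ → List (Move n) → ℝ → ℝ
  | x, [], _ => x
  | x, m :: L, t =>
      if t ≤ m.start then x
      else if t ≤ m.start + m.length then
        (if m.src ≤ m.dst then m.src + (t - m.start) else m.src - (t - m.start))
      else positionFrom m.dst L t

/-- The strategy can be executed by the agents starting at time `0` from `pos`. -/
def Strategy.Feasible {n : ℕ} (S : Strategy n) (ℓ : ℝ) (pos : Fin n → ℝ) : Prop :=
  ∀ i, FeasibleFrom ℓ 0 (pos i) (S.movesOf i)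

/-- The trajectories of the agents. -/
noncomputable def Strategy.trajectory {n : ℕ} (S : Strategy n) (pos : Fin n → ℝ)
    (i : Fin n) (t : ℝ) : ℝ :=
  positionFrom (pos i) (S.movesOf i) t

/-- `Informed x k i t`: if the agents follow the trajectories `x` from time `0` on, then at time
`t` agent `i` holds the initial information of agent `k`. Information is never lost, and it is
passed on whenever two agents are at the same point at the same time. -/
inductive Informed {n : ℕ} (x : Fin n → ℝ → ℝ) (k : Fin n) : Fin n → ℝ → Prop
  | source (t : ℝ) (ht : 0 ≤ t) : Informed x k k t
  | keep (i : Fin n) (s t : ℝ) (hs : Informed x k i s) (hst : s ≤ t) : Informed x k i t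
  | meet (i j : Fin n) (t : ℝ) (hj : Informed x k j t) (hx : x i t = x j t) : Informed x k i t

/-- A broadcast strategy: executable, and every agent gets the information of the source `k`. -/
def Strategy.IsBroadcast {n : ℕ} (S : Strategy n) (ℓ : ℝ) (pos : Fin n → ℝ) (k : Fin n) : Prop :=
  S.Feasible ℓ pos ∧ ∀ i, ∃ t, Informed (S.trajectory pos) k i t

/-- The total distance travelled by agent `i`. -/
def Strategy.distance {n : ℕ} (S : Strategy n) (i : Fin n) : ℝ :=
  ((S.movesOf i).map Move.length).sum

/-- Power `P` for every agent suffices to execute the strategy. -/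
def Strategy.UsesPowerAtMost {n : ℕ} (S : Strategy n) (P : ℝ) : Prop :=
  ∀ i, S.distance i ≤ P

/-- `P` is the smallest power that suffices for broadcast from the source `k`. -/
def IsOptimalBroadcastPower {n : ℕ} (ℓ : ℝ) (pos : Fin n → ℝ) (k : Fin n) (P : ℝ) : Prop :=
  IsLeast {Q : ℝ | ∃ S : Strategy n, S.IsBroadcast ℓ pos k ∧ S.UsesPowerAtMost Q} P

end LineAgents

/-! ## The real RAM

Unit-cost random access machine with exact real arithmetic and comparisons (no rounding and no
conversion between reals and integers). Natural numbers serve as counters and addresses. A program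
names finitely many registers; the memories are reached by indirect addressing. -/

namespace RealRAM

/-- Instructions. A register is named by a natural number; `d` is the target, `l` a line of the
program. -/
inductive Instr
  | iconst (d : ℕ) (c : ℕ)
  | imov (d a : ℕ)
  | iadd (d a b : ℕ)
  | isub (d a b : ℕ)
  | iload (d a : ℕ)
  | istore (a b : ℕ)
  | rconst (d : ℕ) (c : ℚ)
  | rmov (d a : ℕ)
  | radd (d a b : ℕ)
  | rsub (d a b : ℕ)
  | rmul (d a b : ℕ)
  | rdiv (d a b : ℕ)
  | rload (d a : ℕ)
  | rstore (a b : ℕ)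
  | jump (l : ℕ)
  | jumpIfIntLe (a b l : ℕ)
  | jumpIfRealLe (a b l : ℕ)
  | halt

/-- A program is a finite list of instructions, the lines being numbered from `0`. -/
abbrev Program := List Instr

/-- A state: program counter, integer and real registers, integer and real memory. -/
structure State where
  pc : ℕ
  ireg : ℕ → ℕ
  rreg : ℕ → ℝ
  imem : ℕ → ℕ
  rmem : ℕ → ℝ

/-- Write an integer register and go to the next line. -/
def State.setI (s : State) (d v : ℕ) : State :=
  { s with pc := s.pc + 1, ireg := Function.update s.ireg d v }

/-- Write a real register and go to the next line. -/
noncomputable def State.setR (s : State) (d : ℕ) (v : ℝ) : State :=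
  { s with pc := s.pc + 1, rreg := Function.update s.rreg d v }

/-- The effect of one instruction; `none` if there is no next state (the machine has halted, or
a division by zero is attempted). -/
noncomputable def exec (s : State) : Instr → Option State
  | .iconst d c => some (s.setI d c)
  | .imov d a => some (s.setI d (s.ireg a))
  | .iadd d a b => some (s.setI d (s.ireg a + s.ireg b))
  | .isub d a b => some (s.setI d (s.ireg a - s.ireg b))
  | .iload d a => some (s.setI d (s.imem (s.ireg a)))
  | .istore a b =>
      some { s with pc := s.pc + 1, imem := Function.update s.imem (s.ireg a) (s.ireg b) }
  | .rconst d c => some (s.setR d (c : ℝ))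
  | .rmov d a => some (s.setR d (s.rreg a))
  | .radd d a b => some (s.setR d (s.rreg a + s.rreg b))
  | .rsub d a b => some (s.setR d (s.rreg a - s.rreg b))
  | .rmul d a b => some (s.setR d (s.rreg a * s.rreg b))
  | .rdiv d a b => if s.rreg b = 0 then none else some (s.setR d (s.rreg a / s.rreg b))
  | .rload d a => some (s.setR d (s.rmem (s.ireg a)))
  | .rstore a b =>
      some { s with pc := s.pc + 1, rmem := Function.update s.rmem (s.ireg a) (s.rreg b) }
  | .jump l => some { s with pc := l }
  | .jumpIfIntLe a b l => some { s with pc := if s.ireg a ≤ s.ireg b then l else s.pc + 1 }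
  | .jumpIfRealLe a b l => some { s with pc := if s.rreg a ≤ s.rreg b then l else s.pc + 1 }
  | .halt => none

/-- One step: execute the instruction at the program counter. -/
noncomputable def step (p : Program) (s : State) : Option State :=
  (p[s.pc]?).bind (exec s)

/-- The state after exactly `t` steps, if there is one. -/
noncomputable def run (p : Program) : ℕ → State → Option State
  | 0, s => some s
  | t + 1, s => (step p s).bind (run p t)

/-- Started in `s`, the program arrives after at most `T` steps at a `halt` instruction, in the
state `s'`. -/
def HaltsWithin (p : Program) (s : State) (T : ℕ) (s' : State) : Prop :=
  ∃ t ≤ T, run p t s = some s' ∧ p[s'.pc]? = some Instr.halt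

end RealRAM

namespace LineAgents

/-- The initial state of the machine: the number of agents and the (zero-based) number of the
source in the integer registers `0` and `1`, the initial positions in the cells `0, …, n - 1` of
the real memory, and zeros everywhere else. -/
noncomputable def inputState {n : ℕ} (pos : Fin n → ℝ) (k : Fin n) : RealRAM.State where
  pc := 0
  ireg := fun r => if r = 0 then n else if r = 1 then (k : ℕ) else 0
  rreg := fun _ => 0
  imem := fun _ => 0
  rmem := fun a => if h : a < n then pos ⟨a, h⟩ else 0

/-- The output read off a state: the power in the real register `0`, the number of movements of
the strategy in the integer register `0`, and the movements, one after the other, in two arrays: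
the agents in the integer memory from the address in the integer register `1` on, and the triples
(starting time, starting point, end point) in the real memory from the address in the integer
register `2` on. -/
def Outputs {n : ℕ} (s : RealRAM.State) (P : ℝ) (S : Strategy n) : Prop :=
  s.rreg 0 = P ∧ s.ireg 0 = S.length ∧
    ∀ (j : ℕ) (hj : j < S.length),
      s.imem (s.ireg 1 + j) = (S[j].agent : ℕ) ∧
      s.rmem (s.ireg 2 + 3 * j) = S[j].start ∧
      s.rmem (s.ireg 2 + 3 * j + 1) = S[j].src ∧
      s.rmem (s.ireg 2 + 3 * j + 2) = S[j].dst

end LineAgents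

/-! Distances are measured from the source on one of its sides. Suppose the agents farther out need
the information at distance `d - P`. An agent starting at `p` that fetches it at `z` and delivers it
there spends `(p - z) + (d - P - z)`, so with power `P` it must fetch at `z = (p + d) / 2 - P` or
beyond. Iterating `d ↦ (p + d) / 2` from the farthest agent inwards gives `relay`. Using the agents
in order of distance is best, because the sorted list minimizes `relay` among its permutations
(`relay_le_of_perm`).

Lower bound for a power `Q`. A group without the source can be informed only if an outsider comes to
distance `relay - Q` (`Spread.exists_reach`). For the `j` farthest agents of a side, outsiders start
no farther than the next agent at `q j`, whence `relayAcc q j - q j ≤ 2 * Q`. Now let the two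
complete sides have relay values `c, b > Q`. Either the source itself visits both `c - Q` and `-(b -
Q)`, which costs `2 * c + b ≤ 4 * Q` or `c + 2 * b ≤ 4 * Q` according to the order of the visits; or
an agent of one side helps on the other, and `Spread.two_mul_relay_add_le` gives an inequality of
the same form, since that agent is then of little use at home. `broadcastPower` is the maximum of
these bounds.

Upper bound. With that power, two movements per agent suffice: go to the place of reception, wait,
carry the information to the next agent. The source visits the side of smaller relay value first,
since the first leg is walked twice (`twoMoveStrategy_optimal`).

All quantities obey one-pass recursions, so a fixed number of scans over the agents computes the
power and the movements. The program is built from straight-line blocks and counted repetitions,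
whose semantics and step bounds are proved once (`haltsWithin_phases`); its effect is then found by
symbolic execution and loop invariants. -/

namespace LineAgents

/-! ## Relay values -/

/-- The distance `d` such that agents at the given distances, used in the given order as a relay
chain with power `P` each, need the information to be brought to distance `d - P`. -/
noncomputable def relay : List ℝ → ℝ
  | [] => 0
  | [p] => p
  | p :: q :: l => (p + relay (q :: l)) / 2

theorem relay_cons {l : List ℝ} (p : ℝ) (hl : l ≠ []) : relay (p :: l) = (p + relay l) / 2 := by
  cases l with
  | nil => exact absurd rfl hl
  | cons q l => rfl

/-- Each entry weighs twice as much as the next one in `relay`, except that the last two weigh the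
same. Hence moving the smaller of two adjacent entries forward never increases the value. -/
theorem relay_orderedInsert_le (h : ℝ) (l : List ℝ) :
    relay (l.orderedInsert (· ≤ ·) h) ≤ relay (h :: l) := by
  induction l with
  | nil => simp
  | cons a l ih =>
    rw [List.orderedInsert_cons]
    split_ifs with hle
    · exact le_rfl
    · rw [relay_cons a (List.ne_nil_of_mem ((List.mem_orderedInsert _).2 (Or.inl rfl))),
        relay_cons h (List.cons_ne_nil a l)]
      by_cases hl : l = []
      · subst hl
        simp only [List.orderedInsert_nil, relay]
        linarith
      · rw [relay_cons a hl]
        rw [relay_cons h hl] at ih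
        linarith [not_le.1 hle]

theorem relay_insertionSort_le (l : List ℝ) :
    relay (l.insertionSort (· ≤ ·)) ≤ relay l := by
  induction l with
  | nil => simp
  | cons a l ih =>
    rw [List.insertionSort_cons]
    refine (relay_orderedInsert_le _ _).trans ?_
    by_cases hl : l = []
    · subst hl; simp
    · have hs : l.insertionSort (· ≤ ·) ≠ [] := fun h =>
        hl (List.Perm.nil_eq (h ▸ (List.perm_insertionSort (· ≤ ·) l))).symm
      rw [relay_cons a hs, relay_cons a hl]
      linarith

theorem relay_le_of_perm {l l' : List ℝ} (hs : l.Pairwise (· ≤ ·)) (hp : l.Perm l') :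
    relay l ≤ relay l' := by
  have h : l = l'.insertionSort (· ≤ ·) :=
    (hp.trans (List.perm_insertionSort _ l').symm).eq_of_pairwise
      (fun a b _ _ => le_antisymm) hs (List.pairwise_insertionSort _ l')
  rw [h]
  exact relay_insertionSort_le l'

/-- If the agents of `U` are informed at the distances `z`, either from outside at a distance at
most `Y`, or by agents of `U` of lower rank, then `Y` is large. -/
theorem exists_relay_le {ι α : Type*} [DecidableEq ι] [LinearOrder α] (rank : ι → α)
    (p z : ι → ℝ) (P : ℝ) (U : Finset ι) : ∀ (Y : ℝ), U.Nonempty →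
    (∀ i ∈ U, p i - P ≤ z i) →
    (∀ i ∈ U, z i ≤ Y ∨ ∃ j ∈ U, rank j < rank i ∧ z i ≤ P - p j + 2 * z j) →
    ∃ l : List ℝ, (l : Multiset ℝ) = U.val.map p ∧ relay l ≤ Y + P := by
  induction U using Finset.strongInduction with
  | H U ih =>
    intro Y hU hlow hup
    -- The agent of lowest rank has no informer in `U`, so it is served from outside. Once it is
    -- removed it counts as an outsider for the rest, and raises the outside bound at most to the
    -- distance it can still carry to.
    obtain ⟨i, hi, hmin⟩ := Finset.exists_min_image U rank hU
    have hzi : z i ≤ Y := by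
      rcases hup i hi with h | ⟨j, hj, hlt, -⟩
      · exact h
      · exact absurd hlt (not_lt.2 (hmin j hj))
    have hval : U.val.map p = p i ::ₘ (U.erase i).val.map p := by
      conv_lhs => rw [← Finset.insert_erase hi]
      rw [Finset.insert_val_of_notMem (Finset.notMem_erase i U), Multiset.map_cons]
    by_cases hne : (U.erase i).Nonempty
    · obtain ⟨l, hl, hle⟩ := ih (U.erase i) (Finset.erase_ssubset hi)
        (max Y (P - p i + 2 * z i)) hne (fun j hj => hlow j (Finset.mem_of_mem_erase hj))
        (fun j hj => by
          rcases hup j (Finset.mem_of_mem_erase hj) with h | ⟨g, hg, hlt, h⟩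
          · exact Or.inl (le_max_of_le_left h)
          · by_cases hgi : g = i
            · exact Or.inl (le_max_of_le_right (hgi ▸ h))
            · exact Or.inr ⟨g, Finset.mem_erase.2 ⟨hgi, hg⟩, hlt, h⟩)
      refine ⟨p i :: l, by rw [hval, ← hl]; rfl, ?_⟩
      have hl0 : l ≠ [] := by
        rintro rfl
        have : (U.erase i).val.map p = 0 := hl.symm
        simp only [Multiset.map_eq_zero, Finset.val_eq_zero] at this
        exact hne.ne_empty this
      rw [relay_cons _ hl0]
      -- If `Y` is the maximum, both `p i` and `relay l` are at most `Y + P`, hence so is their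
      -- mean. Otherwise `relay l ≤ 2 * P - p i + 2 * z i`, and the mean is at most `P + z i`.
      rcases le_max_iff.1 (sub_le_iff_le_add.2 hle) with h | h <;> linarith [hlow i hi]
    · rw [Finset.not_nonempty_iff_eq_empty] at hne
      refine ⟨[p i], by rw [hval, hne]; rfl, ?_⟩
      simp only [relay]
      linarith [hlow i hi]

theorem relay_le {ι α : Type*} [DecidableEq ι] [LinearOrder α] (rank : ι → α)
    (p z : ι → ℝ) {P Y : ℝ} {U : Finset ι} {l : List ℝ} (hs : l.Pairwise (· ≤ ·))
    (hl : (l : Multiset ℝ) = U.val.map p) (hU : U.Nonempty) (hlow : ∀ i ∈ U, p i - P ≤ z i)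
    (hup : ∀ i ∈ U, z i ≤ Y ∨ ∃ j ∈ U, rank j < rank i ∧ z i ≤ P - p j + 2 * z j) :
    relay l ≤ Y + P := by
  obtain ⟨l', hl', hle⟩ := exists_relay_le rank p z P U Y hU hlow hup
  exact (relay_le_of_perm hs (Multiset.coe_eq_coe.1 (hl.trans hl'.symm))).trans hle

/-! ## Spreading of the information -/

/-- Trajectories of total length at most `Q`, and for each agent a time at which it is informed by
an agent that precedes it in the order given by `rank`. -/
structure Spread {n : ℕ} (x : Fin n → ℝ → ℝ) (k : Fin n) (Q : ℝ) (τ : Fin n → ℝ)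
    (rank : Fin n → ℝ ×ₗ ℕ) : Prop where
  path : ∀ i s t u, 0 ≤ s → s ≤ t → t ≤ u →
    |x i s - x i 0| + |x i t - x i s| + |x i u - x i t| ≤ Q
  nonneg : ∀ i, 0 ≤ τ i
  parent : ∀ i, i ≠ k → ∃ j, rank j < rank i ∧ τ j ≤ τ i ∧ x i (τ i) = x j (τ i)

namespace Spread

variable {n : ℕ} {x : Fin n → ℝ → ℝ} {k : Fin n} {Q : ℝ} {τ : Fin n → ℝ}
  {rank : Fin n → ℝ ×ₗ ℕ}

/-- Reflection lets every estimate for the right side serve for the left side too. -/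
theorem neg (h : Spread x k Q τ rank) : Spread (fun i t => -x i t) k Q τ rank where
  path i s t u hs ht hu := by
    have := h.path i s t u hs ht hu
    simp only [neg_sub_neg]
    rwa [abs_sub_comm (x i 0) (x i s), abs_sub_comm (x i s) (x i t), abs_sub_comm (x i t) (x i u)]
  nonneg := h.nonneg
  parent i hi := by simpa using h.parent i hi

theorem sub_const (h : Spread x k Q τ rank) (a : ℝ) :
    Spread (fun i t => x i t - a) k Q τ rank where
  path i s t u hs ht hu := by simpa using h.path i s t u hs ht hu
  nonneg := h.nonneg
  parent i hi := by simpa using h.parent i hi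

theorem path_one (h : Spread x k Q τ rank) (i : Fin n) {s : ℝ} (hs : 0 ≤ s) :
    |x i s - x i 0| ≤ Q := by
  simpa using h.path i s s s hs le_rfl le_rfl

theorem path_two (h : Spread x k Q τ rank) (i : Fin n) {s t : ℝ} (hs : 0 ≤ s) (ht : s ≤ t) :
    |x i s - x i 0| + |x i t - x i s| ≤ Q := by
  simpa using h.path i s t t hs ht le_rfl

theorem power_nonneg (h : Spread x k Q τ rank) : 0 ≤ Q :=
  (abs_nonneg _).trans (h.path_one k le_rfl)

/-- The agents of `U` can be informed only if an agent from outside comes close. -/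
theorem exists_reach (h : Spread x k Q τ rank) {U : Finset (Fin n)} (hk : k ∉ U)
    (hU : U.Nonempty) {l : List ℝ} (hs : l.Pairwise (· ≤ ·))
    (hl : (l : Multiset ℝ) = U.val.map (fun i => x i 0)) :
    ∃ g ∉ U, ∃ t, 0 ≤ t ∧ relay l - Q ≤ x g t := by
  -- Only the finitely many moments `τ i` at which members of `U` are informed matter, so the
  -- farthest outsider at such a moment exists and bounds everything delivered from outside.
  obtain ⟨⟨i, g⟩, hig, hmax⟩ := Finset.exists_max_image (U ×ˢ Uᶜ)
    (fun a => x a.2 (τ a.1)) (hU.product ⟨k, Finset.mem_compl.2 hk⟩)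
  rw [Finset.mem_product, Finset.mem_compl] at hig
  refine ⟨g, hig.2, τ i, h.nonneg i, ?_⟩
  rw [sub_le_iff_le_add]
  refine relay_le rank _ (fun i => x i (τ i)) hs hl hU (fun j _ => ?_) (fun j hj => ?_)
  · have := abs_le.1 (h.path_one j (h.nonneg j))
    linarith
  · obtain ⟨e, hlt, hle, heq⟩ := h.parent j (fun hjk => hk (hjk ▸ hj))
    by_cases he : e ∈ U
    · refine Or.inr ⟨e, he, hlt, ?_⟩
      have := h.path_two e (h.nonneg e) hle
      have h1 := neg_abs_le (x e (τ e) - x e 0)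
      have h2 := le_abs_self (x e (τ j) - x e (τ e))
      linarith
    · exact Or.inl (heq ▸ hmax (j, e) (Finset.mk_mem_product hj (Finset.mem_compl.2 he)))

/-- An outsider starting at most at `Y` gets at most to `Y + Q`, and one of them has to get to
`relay l - Q`. -/
theorem relay_le_of_bound (h : Spread x k Q τ rank) {U : Finset (Fin n)} (hk : k ∉ U)
    {l : List ℝ} (hs : l.Pairwise (· ≤ ·)) (hU : U.Nonempty)
    (hl : (l : Multiset ℝ) = U.val.map (fun i => x i 0)) {Y : ℝ}
    (hY : ∀ i ∉ U, x i 0 ≤ Y) : relay l - Y ≤ 2 * Q := by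
  obtain ⟨g, hg, t, ht, hle⟩ := h.exists_reach hk hU hs hl
  linarith [hY g hg, (abs_le.1 (h.path_one g ht)).2]

/-- If an agent `a` of the group `V` on the positive side of the source gets to `-(c - Q)` on the
other side, then the remaining agents of `V` are difficult to inform. -/
theorem two_mul_relay_add_le (h : Spread x k Q τ rank) {V : Finset (Fin n)} (hk : k ∉ V)
    (hpos : ∀ i ∈ V, 0 ≤ x i 0) (hneg : ∀ i ∉ V, x i 0 ≤ 0) {l : List ℝ}
    (hs : l.Pairwise (· ≤ ·)) (hl : (l : Multiset ℝ) = V.val.map (fun i => x i 0))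
    {a : Fin n} (ha : a ∈ V) {t c : ℝ} (ht : 0 ≤ t) (hc : Q ≤ c) (hat : x a t ≤ -(c - Q)) :
    2 * relay l + c ≤ 4 * Q := by
  have hap := hpos a ha
  have hQ := h.power_nonneg
  have hreach : x a 0 + c ≤ 2 * Q := by
    linarith [(abs_le.1 (h.path_one a ht)).1]
  have hval : V.val.map (fun i => x i 0) = x a 0 ::ₘ (V.erase a).val.map (fun i => x i 0) := by
    conv_lhs => rw [← Finset.insert_erase ha]
    rw [Finset.insert_val_of_notMem (Finset.notMem_erase a V), Multiset.map_cons]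
  by_cases hne : (V.erase a).Nonempty
  · have hmem : ∀ i, i ∈ V.erase a ↔ i ≠ a ∧ i ∈ V := fun i => Finset.mem_erase
    set δ : ℝ := (2 * Q - c - x a 0) / 2 with hδ
    -- The way of `a` to `-(c - Q)` costs at least `x a 0 + c - Q`, so `2 * δ` is the most it can
    -- spend on a detour, and `δ` the farthest it can carry the information outwards before the
    -- visit.
    have hδ0 : 0 ≤ δ := by rw [hδ]; linarith
    have hout : ∀ j ∉ V, ∀ s, 0 ≤ s → x j s ≤ Q := fun j hj s hs => by
      linarith [hneg j hj, (abs_le.1 (h.path_one j hs)).2]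
    have hin : ∀ j s, τ j ≤ s → x j s ≤ Q - x j 0 + 2 * x j (τ j) := fun j s hs => by
      have := h.path_two j (h.nonneg j) hs
      have h1 := neg_abs_le (x j (τ j) - x j 0)
      have h2 := le_abs_self (x j s - x j (τ j))
      linarith
    -- Agent `a` is bypassed: whoever it informs is treated as informed by its own informer, with an
    -- error of at most `δ`. Lowering all places by `δ` and raising the power to `Q + 2 * δ` leaves
    -- the carrying bound `Q - x j 0 + 2 * x j (τ j)` as it is and allows exactly this error. The
    -- result is `relay l' ≤ 4 * Q - c - x a 0`.
    obtain ⟨l', hl', hle⟩ := exists_relay_le rank (fun i => x i 0) (fun i => x i (τ i) - δ)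
      (Q + 2 * δ) (V.erase a) Q hne
      (fun i _ => by
        have := abs_le.1 (h.path_one i (h.nonneg i))
        linarith)
      (fun i hi => by
        obtain ⟨hia, hiV⟩ := (hmem i).1 hi
        obtain ⟨j, hlt, hle, heq⟩ := h.parent i (fun hik => hk (hik ▸ hiV))
        simp only [heq]
        by_cases hjV : j ∈ V
        · by_cases hja : j = a
          · subst hja
            -- After the visit to the other side, `a` cannot get back beyond the reach of the
            -- outsiders.
            rcases le_total t (τ i) with hti | hti
            · left
              have := h.path_two j ht hti
              have h1 := neg_abs_le (x j t - x j 0)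
              have h2 := le_abs_self (x j (τ i) - x j t)
              linarith
            -- Before the visit, an advance from the place where `a` was informed is paid for twice.
            -- This is the only genuine use of all three legs of `Spread.path`.
            · have h0 := h.path j (τ j) (τ i) t (h.nonneg j) hle hti
              have h1 := neg_abs_le (x j (τ j) - x j 0)
              have h2 := le_abs_self (x j (τ i) - x j (τ j))
              have h3 := neg_abs_le (x j t - x j (τ i))
              have h4 : x j (τ i) ≤ x j (τ j) + δ := by rw [hδ]; linarith
              obtain ⟨g, hg1, hg2, hg3⟩ := h.parent j (fun hjk => hk (hjk ▸ hjV))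
              by_cases hgV : g ∈ V
              · right
                have hgj : g ≠ j := fun hgj => lt_irrefl _ (hgj ▸ hg1)
                refine ⟨g, (hmem g).2 ⟨hgj, hgV⟩, hg1.trans hlt, ?_⟩
                linarith [hin g (τ j) hg2]
              · left
                linarith [hout g hgV (τ j) (h.nonneg j)]
          · right
            refine ⟨j, (hmem j).2 ⟨hja, hjV⟩, hlt, ?_⟩
            linarith [hin j (τ i) hle]
        · left
          linarith [hout j hjV (τ i) (h.nonneg i)])
    have hl0 : l' ≠ [] := by
      rintro rfl
      have : (V.erase a).val.map (fun i => x i 0) = 0 := hl'.symm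
      simp only [Multiset.map_eq_zero, Finset.val_eq_zero] at this
      exact hne.ne_empty this
    have hperm : l.Perm (x a 0 :: l') := by
      rw [← Multiset.coe_eq_coe, hl, hval, ← hl']
      rfl
    have := relay_le_of_perm hs hperm
    rw [relay_cons _ hl0] at this
    rw [hδ] at hle
    linarith
  · rw [Finset.not_nonempty_iff_eq_empty] at hne
    have hperm : l.Perm [x a 0] := by
      rw [← Multiset.coe_eq_coe, hl, hval, hne]
      rfl
    rw [List.perm_singleton.1 hperm]
    simp only [relay]
    linarith

/-- The source, or the agents that replace it, have to serve both sides. -/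
theorem both_sides (h : Spread x k Q τ rank) (hx : x k 0 = 0) {U V : Finset (Fin n)}
    (hU : ∀ i, i ∈ U ↔ 0 < x i 0) (hV : ∀ i, i ∈ V ↔ x i 0 < 0) (hk : ∀ i, x i 0 = 0 → i = k)
    {l l' : List ℝ} (hs : l.Pairwise (· ≤ ·)) (hs' : l'.Pairwise (· ≤ ·))
    (hl : (l : Multiset ℝ) = U.val.map (fun i => x i 0))
    (hl' : (l' : Multiset ℝ) = V.val.map (fun i => -x i 0))
    (hUQ : relay l ≤ 2 * Q) (hVQ : relay l' ≤ 2 * Q) :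
    2 * relay l + relay l' ≤ 4 * Q ∨ relay l + 2 * relay l' ≤ 4 * Q := by
  have hQ := h.power_nonneg
  -- If one relay value is at most `Q`, the claim follows from the bound `2 * Q` on the other.
  -- Otherwise both sides are nonempty and both need a visit at a positive distance from the source.
  rcases le_or_gt (relay l) Q with hc | hc
  · left; linarith
  rcases le_or_gt (relay l') Q with hb | hb
  · right; linarith
  have hkU : k ∉ U := by simp [hU, hx]
  have hkV : k ∉ V := by simp [hV, hx]
  have hUne : U.Nonempty := by
    rw [Finset.nonempty_iff_ne_empty]
    rintro rfl
    have : l = [] := by simpa using hl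
    subst this
    simp only [relay] at hc
    linarith
  have hVne : V.Nonempty := by
    rw [Finset.nonempty_iff_ne_empty]
    rintro rfl
    have : l' = [] := by simpa using hl'
    subst this
    simp only [relay] at hb
    linarith
  obtain ⟨g, hg, s, hs0, hgs⟩ := h.exists_reach hkU hUne hs hl
  obtain ⟨e, he, t, ht0, het⟩ := h.neg.exists_reach hkV hVne hs' hl'
  by_cases hgV : g ∈ V
  · right
    have := h.neg.two_mul_relay_add_le hkV (fun i hi => by linarith [(hV i).1 hi])
      (fun i hi => by
        rw [hV, not_lt] at hi
        linarith) hs' hl' hgV hs0 hc.le (by linarith)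
    linarith
  by_cases heU : e ∈ U
  · left
    have := h.two_mul_relay_add_le hkU (fun i hi => by linarith [(hU i).1 hi])
      (fun i hi => by
        rw [hU, not_lt] at hi
        linarith) hs hl heU ht0 hb.le (by linarith)
    linarith
  -- No agent crosses over, so both visits are made by the source; in the order of the visits, the
  -- first distance is walked twice.
  have hgk : g = k := hk g (by
    rw [hU, not_lt] at hg
    rw [hV, not_lt] at hgV
    exact le_antisymm hg hgV)
  have hek : e = k := hk e (by
    rw [hU, not_lt] at heU
    rw [hV, not_lt] at he
    exact le_antisymm heU he)
  subst hgk
  subst hek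
  rcases le_total s t with hst | hst
  · left
    have := h.path_two e hs0 hst
    have h1 := le_abs_self (x e s - x e 0)
    have h2 := neg_abs_le (x e t - x e s)
    linarith
  · right
    have := h.path_two e ht0 hst
    have h1 := neg_abs_le (x e t - x e 0)
    have h2 := le_abs_self (x e s - x e t)
    linarith

end Spread

end LineAgents

namespace LineAgents

/-! ## Distances travelled -/

/-- The distance travelled up to time `t`. -/
noncomputable def travelled {n : ℕ} : List (Move n) → ℝ → ℝ
  | [], _ => 0
  | m :: L, t =>
      if t ≤ m.start then 0
      else if t ≤ m.start + m.length then t - m.start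
      else m.length + travelled L t

variable {n : ℕ}

theorem Move.length_nonneg (m : Move n) : 0 ≤ m.length := abs_nonneg _

theorem travelled_nonneg (L : List (Move n)) (t : ℝ) : 0 ≤ travelled L t := by
  induction L with
  | nil => exact le_rfl
  | cons m L ih =>
    rw [travelled]
    split_ifs with h1 h2
    · exact le_rfl
    · linarith
    · linarith [m.length_nonneg]

theorem travelled_le (L : List (Move n)) (t : ℝ) :
    travelled L t ≤ (L.map Move.length).sum := by
  induction L with
  | nil => exact le_rfl
  | cons m L ih =>
    have hnn : 0 ≤ (L.map Move.length).sum := (travelled_nonneg L t).trans ih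
    rw [travelled, List.map_cons, List.sum_cons]
    split_ifs with h1 h2 <;> linarith [m.length_nonneg]

theorem positionFrom_eq_of_le {ℓ t x s : ℝ} {L : List (Move n)} (hL : FeasibleFrom ℓ t x L)
    (hs : s ≤ t) : positionFrom x L s = x ∧ travelled L s = 0 := by
  cases L with
  | nil => exact ⟨rfl, rfl⟩
  | cons m L =>
    have h : s ≤ m.start := hs.trans hL.1
    simp [positionFrom, travelled, h]

/-- Displacement is bounded by the increase of `travelled`, so the bounds for consecutive legs
telescope. This turns the power of a strategy into `Spread.path`. -/
theorem abs_positionFrom_sub_le {ℓ : ℝ} (L : List (Move n)) :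
    ∀ (t₀ x s t : ℝ), FeasibleFrom ℓ t₀ x L → s ≤ t →
      |positionFrom x L t - positionFrom x L s| ≤ travelled L t - travelled L s := by
  induction L with
  | nil => intro t₀ x s t _ _; simp [positionFrom, travelled]
  | cons m L ih =>
    intro t₀ x s t hL hst
    obtain ⟨-, hsrc, -, hL'⟩ := hL
    subst hsrc
    have hlen : m.length = |m.dst - m.src| := rfl
    have hnn := m.length_nonneg
    obtain ⟨hp, ht⟩ := positionFrom_eq_of_le hL' le_rfl
    have key : m.start + m.length ≤ t →
        |positionFrom m.dst L t - m.dst| ≤ travelled L t := fun h => by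
      simpa [hp, ht] using ih _ _ _ _ hL' h
    simp only [positionFrom, travelled]
    by_cases h1 : t ≤ m.start
    · simp [h1, hst.trans h1]
    by_cases h2 : t ≤ m.start + m.length
    · by_cases h3 : s ≤ m.start
      · simp only [h1, h2, h3, if_true, if_false]
        split_ifs <;> rw [abs_le] <;> constructor <;> linarith
      · simp only [h1, h2, h3, hst.trans h2, if_true, if_false]
        split_ifs <;> rw [abs_le] <;> constructor <;> linarith
    · have h2' := (not_le.1 h2).le
      have hk := abs_le.1 (key h2')
      by_cases h3 : s ≤ m.start
      · simp only [h1, h2, h3, if_true, if_false]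
        rw [hlen, abs_le]
        have := le_abs_self (m.dst - m.src)
        have := neg_abs_le (m.dst - m.src)
        constructor <;> linarith
      by_cases h4 : s ≤ m.start + m.length
      · simp only [h1, h2, h3, h4, if_true, if_false]
        split_ifs with h5
        · rw [abs_of_nonneg (sub_nonneg.2 h5)] at hlen
          rw [abs_le]
          constructor <;> linarith
        · rw [abs_of_neg (by linarith)] at hlen
          rw [abs_le]
          constructor <;> linarith
      · simp only [h1, h2, h3, h4, if_false]
        linarith [ih _ _ _ _ hL' hst]

/-! ## The order in which the agents are informed -/

/-- A finite set of events `(i, t, d)`, agent `i` being informed at time `t`, in which every event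
is caused by one that is not later and has smaller depth `d`. -/
def CausallyClosed (x : Fin n → ℝ → ℝ) (k : Fin n) (E : Finset (Fin n × ℝ × ℕ)) : Prop :=
  ∀ e ∈ E, 0 ≤ e.2.1 ∧ (e.1 ≠ k → ∃ e' ∈ E, e'.2.1 ≤ e.2.1 ∧ e'.2.2 < e.2.2 ∧
    x e.1 e.2.1 = x e'.1 e.2.1)

/-- A derivation of `Informed` is finite, and its meetings are the events. The depth orders several
meetings at the same time. With finitely many events, first ones exist without any limit argument on
the times at which an agent is informed. -/
theorem Informed.exists_causallyClosed {x : Fin n → ℝ → ℝ} {k i : Fin n} {t : ℝ}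
    (h : Informed x k i t) :
    ∃ E, CausallyClosed x k E ∧ ∃ s d, s ≤ t ∧ (i, s, d) ∈ E := by
  induction h with
  | source t ht =>
    refine ⟨{(k, t, 0)}, fun e he => ?_, t, 0, le_rfl, Finset.mem_singleton_self _⟩
    rw [Finset.mem_singleton] at he
    subst he
    exact ⟨ht, fun h => absurd rfl h⟩
  | keep i s t _ hst ih =>
    obtain ⟨E, hE, r, d, hr, hm⟩ := ih
    exact ⟨E, hE, r, d, hr.trans hst, hm⟩
  | meet i j t _ hx ih =>
    obtain ⟨E, hE, r, d, hr, hm⟩ := ih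
    refine ⟨insert (i, t, d + 1) E, fun e he => ?_, t, d + 1, le_rfl,
      Finset.mem_insert_self _ _⟩
    rcases Finset.mem_insert.1 he with rfl | he
    · exact ⟨(hE _ hm).1.trans hr, fun _ =>
        ⟨_, Finset.mem_insert_of_mem hm, hr, Nat.lt_succ_self d, hx⟩⟩
    · refine ⟨(hE e he).1, fun hk => ?_⟩
      obtain ⟨e', he', h⟩ := (hE e he).2 hk
      exact ⟨e', Finset.mem_insert_of_mem he', h⟩

theorem exists_rank {x : Fin n → ℝ → ℝ} {k : Fin n} (h : ∀ i, ∃ t, Informed x k i t) :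
    ∃ (τ : Fin n → ℝ) (rank : Fin n → ℝ ×ₗ ℕ), (∀ i, 0 ≤ τ i) ∧
      ∀ i, i ≠ k → ∃ j, rank j < rank i ∧ τ j ≤ τ i ∧ x i (τ i) = x j (τ i) := by
  choose t ht using h
  choose E hE s d _ hm using fun i => (ht i).exists_causallyClosed
  set F := Finset.univ.biUnion E with hF
  have hFm : ∀ e, e ∈ F ↔ ∃ i, e ∈ E i := fun e => by simp [hF]
  have hclosed : CausallyClosed x k F := fun e he => by
    obtain ⟨i, hi⟩ := (hFm e).1 he
    refine ⟨(hE i e hi).1, fun hk => ?_⟩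
    obtain ⟨e', he', h⟩ := (hE i e hi).2 hk
    exact ⟨e', (hFm e').2 ⟨i, he'⟩, h⟩
  -- The rank of an agent is its lexicographically least pair of time and depth. The cause of that
  -- event is smaller, and the rank of the informer is at most that of the cause.
  have hmin : ∀ i, ∃ e ∈ F, e.1 = i ∧ ∀ e' ∈ F, e'.1 = i → toLex e.2 ≤ toLex e'.2 := fun i => by
    obtain ⟨e, he, hle⟩ := Finset.exists_min_image (F.filter (fun e => e.1 = i))
      (fun e => toLex e.2) ⟨(i, s i, d i), by simpa [hFm] using ⟨i, hm i⟩⟩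
    rw [Finset.mem_filter] at he
    exact ⟨e, he.1, he.2, fun e' h1 h2 => hle e' (Finset.mem_filter.2 ⟨h1, h2⟩)⟩
  choose e heF hei hele using hmin
  refine ⟨fun i => (e i).2.1, fun i => toLex (e i).2, fun i => (hclosed _ (heF i)).1,
    fun i hi => ?_⟩
  obtain ⟨e', he', h1, h2, h3⟩ := (hclosed _ (heF i)).2 (by rwa [hei i])
  have hle := hele e'.1 e' he' rfl
  refine ⟨e'.1, hle.trans_lt ?_, ?_, by rwa [hei i] at h3⟩
  · rw [Prod.Lex.toLex_lt_toLex]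
    rcases h1.lt_or_eq with h | h
    · exact Or.inl h
    · exact Or.inr ⟨h, h2⟩
  · rw [Prod.Lex.toLex_le_toLex] at hle
    rcases hle with h | h
    · exact h.le.trans h1
    · exact h.1.le.trans h1

/-- A broadcast strategy spreads the information. -/
theorem Strategy.IsBroadcast.exists_spread {S : Strategy n} {ℓ Q : ℝ} {pos : Fin n → ℝ}
    {k : Fin n} (h : S.IsBroadcast ℓ pos k) (hQ : S.UsesPowerAtMost Q) :
    (∀ i, S.trajectory pos i 0 = pos i) ∧
      ∃ τ rank, Spread (S.trajectory pos) k Q τ rank := by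
  refine ⟨fun i => (positionFrom_eq_of_le (h.1 i) le_rfl).1, ?_⟩
  obtain ⟨τ, rank, h0, hpar⟩ := exists_rank h.2
  refine ⟨τ, rank, fun i s t u hs hst htu => ?_, h0, hpar⟩
  have h1 := abs_positionFrom_sub_le _ _ _ _ _ (h.1 i) hs
  have h2 := abs_positionFrom_sub_le _ _ _ _ _ (h.1 i) hst
  have h3 := abs_positionFrom_sub_le _ _ _ _ _ (h.1 i) htu
  have h4 := (travelled_le (S.movesOf i) u).trans (hQ i)
  have h5 := travelled_nonneg (S.movesOf i) 0
  simp only [Strategy.trajectory]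
  linarith

end LineAgents

namespace LineAgents

/-! ## The two sides of the source -/

/-- The relay value of the agents at the distances `q 0 > q 1 > ... > q (j - 1)` (and `q 0` if
`j = 0`). -/
noncomputable def relayAcc (q : ℕ → ℝ) : ℕ → ℝ
  | 0 => q 0
  | j + 1 => (relayAcc q j + q j) / 2

/-- The list of the numbers `q (j - 1), ..., q 0`. -/
def nearestFirst (q : ℕ → ℝ) : ℕ → List ℝ
  | 0 => []
  | j + 1 => q j :: nearestFirst q j

theorem relay_nearestFirst (q : ℕ → ℝ) (j : ℕ) :
    relay (nearestFirst q (j + 1)) = relayAcc q (j + 1) := by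
  induction j with
  | zero => simp [nearestFirst, relay, relayAcc]
  | succ j ih =>
    rw [nearestFirst, relay_cons _ (by simp [nearestFirst]), ih, relayAcc.eq_2 q (j + 1), add_comm]

theorem coe_nearestFirst (q : ℕ → ℝ) (j : ℕ) :
    (nearestFirst q j : Multiset ℝ) = (Multiset.range j).map q := by
  induction j with
  | zero => rfl
  | succ j ih =>
    rw [nearestFirst, Multiset.range_succ, Multiset.map_cons, ← ih]
    rfl

theorem mem_nearestFirst {q : ℕ → ℝ} {j : ℕ} {a : ℝ} (h : a ∈ nearestFirst q j) :
    ∃ i < j, q i = a := by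
  rw [← Multiset.mem_coe, coe_nearestFirst] at h
  simpa using h

theorem pairwise_nearestFirst {q : ℕ → ℝ} {m : ℕ} (hq : ∀ i j, i < j → j ≤ m → q j < q i) :
    ∀ j ≤ m, (nearestFirst q j).Pairwise (· ≤ ·)
  | 0, _ => List.Pairwise.nil
  | j + 1, hj => by
    refine List.pairwise_cons.2 ⟨fun a ha => ?_, pairwise_nearestFirst hq j (by omega)⟩
    obtain ⟨i, hi, rfl⟩ := mem_nearestFirst ha
    exact (hq i j hi (by omega)).le

/-- The signed distance from the source of the agent number `j` of a side. -/
noncomputable def sideDist {n : ℕ} (pos : Fin n → ℝ) (k : Fin n) (σ : ℝ) (idx : ℕ → Fin n)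
    (j : ℕ) : ℝ :=
  σ * (pos (idx j) - pos k)

/-- The agents on one side of the source `k`, enumerated by `idx` from the farthest one to the
source, which has the number `m`. -/
structure IsSide {n : ℕ} (pos : Fin n → ℝ) (k : Fin n) (σ : ℝ) (m : ℕ) (idx : ℕ → Fin n) :
    Prop where
  sign : σ = 1 ∨ σ = -1
  last : idx m = k
  anti : ∀ i j, i < j → j ≤ m → sideDist pos k σ idx j < sideDist pos k σ idx i
  outside : ∀ i, ∀ j ≤ m, (∀ j' < j, i ≠ idx j') → σ * (pos i - pos k) ≤ sideDist pos k σ idx j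

/-- The agents to the right of the source, from the last one on. -/
def rightIdx {n : ℕ} (k : Fin n) (j : ℕ) : Fin n := ⟨n - 1 - j, by have := k.2; omega⟩

/-- The agents to the left of the source, from the first one on. -/
def leftIdx {n : ℕ} (k : Fin n) (j : ℕ) : Fin n := ⟨min j k, by have := k.2; omega⟩

section Side

variable {n : ℕ} {pos : Fin n → ℝ} {k : Fin n}

theorem isSide_right (hpos : StrictMono pos) : IsSide pos k 1 (n - 1 - k) (rightIdx k) where
  sign := Or.inl rfl
  last := Fin.ext (by have := k.2; simp only [rightIdx]; omega)
  anti i j hij hj := by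
    have : pos (rightIdx k j) < pos (rightIdx k i) :=
      hpos (Fin.lt_def.2 (by have := k.2; simp only [rightIdx]; omega))
    simp only [sideDist]
    linarith
  outside i j hj h := by
    have : pos i ≤ pos (rightIdx k j) := by
      refine hpos.monotone (Fin.le_def.2 ?_)
      by_contra hlt
      refine h (n - 1 - i) ?_ (Fin.ext ?_) <;> simp only [rightIdx] at * <;> omega
    simp only [sideDist]
    linarith

theorem isSide_left (hpos : StrictMono pos) : IsSide pos k (-1) k (leftIdx k) where
  sign := Or.inr rfl
  last := Fin.ext (by simp [leftIdx])
  anti i j hij hj := by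
    have : pos (leftIdx k i) < pos (leftIdx k j) :=
      hpos (Fin.lt_def.2 (by simp only [leftIdx]; omega))
    simp only [sideDist]
    linarith
  outside i j hj h := by
    have : pos (leftIdx k j) ≤ pos i := by
      refine hpos.monotone (Fin.le_def.2 ?_)
      by_contra hlt
      refine h i ?_ (Fin.ext ?_) <;> simp only [leftIdx] at * <;> omega
    simp only [sideDist]
    linarith

namespace IsSide

variable {σ : ℝ} {m : ℕ} {idx : ℕ → Fin n}

theorem dist_last (h : IsSide pos k σ m idx) : sideDist pos k σ idx m = 0 := by
  simp [sideDist, h.last]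

theorem dist_nonneg (h : IsSide pos k σ m idx) {j : ℕ} (hj : j ≤ m) :
    0 ≤ sideDist pos k σ idx j := by
  rcases hj.lt_or_eq with hj | rfl
  · exact h.dist_last ▸ (h.anti _ _ hj le_rfl).le
  · exact h.dist_last.ge

theorem dist_le_acc (h : IsSide pos k σ m idx) {j : ℕ} (hj : j ≤ m) :
    sideDist pos k σ idx j ≤ relayAcc (sideDist pos k σ idx) j := by
  induction j with
  | zero => exact le_rfl
  | succ j ih =>
    rw [relayAcc]
    linarith [ih (by omega), h.anti j (j + 1) (by omega) hj]

theorem acc_succ_le (h : IsSide pos k σ m idx) {j : ℕ} (hj : j ≤ m) :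
    relayAcc (sideDist pos k σ idx) (j + 1) ≤ relayAcc (sideDist pos k σ idx) j := by
  rw [relayAcc]
  linarith [h.dist_le_acc hj]

theorem acc_le (h : IsSide pos k σ m idx) {j : ℕ} (hj : j ≤ m) :
    relayAcc (sideDist pos k σ idx) j ≤ sideDist pos k σ idx 0 := by
  induction j with
  | zero => exact le_rfl
  | succ j ih => exact (h.acc_succ_le (by omega)).trans (ih (by omega))

theorem relay_eq (h : IsSide pos k σ m idx) :
    relay (nearestFirst (sideDist pos k σ idx) m) = relayAcc (sideDist pos k σ idx) m := by
  cases m with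
  | zero => simp [nearestFirst, relay, relayAcc, h.dist_last]
  | succ m => exact relay_nearestFirst _ _

theorem injOn (h : IsSide pos k σ m idx) : Set.InjOn idx (Set.Iic m) := by
  intro i hi j hj hij
  have he : sideDist pos k σ idx i = sideDist pos k σ idx j := by simp only [sideDist, hij]
  rcases lt_trichotomy i j with hlt | rfl | hlt
  · exact absurd he (h.anti i j hlt hj).ne'
  · rfl
  · exact absurd he (h.anti j i hlt hi).ne

theorem map_image (h : IsSide pos k σ m idx) {j : ℕ} (hj : j ≤ m) :
    (nearestFirst (sideDist pos k σ idx) j : Multiset ℝ) =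
      ((Finset.range j).image idx).val.map (fun i => σ * (pos i - pos k)) := by
  rw [coe_nearestFirst, Finset.image_val_of_injOn, Multiset.map_map]
  · rfl
  · exact h.injOn.mono (fun i hi => by
      have := Finset.mem_range.1 (Finset.mem_coe.1 hi)
      exact Set.mem_Iic.2 (by omega))

theorem mem_image (h : IsSide pos k σ m idx) {i : Fin n} :
    i ∈ (Finset.range m).image idx ↔ 0 < σ * (pos i - pos k) := by
  simp only [Finset.mem_image, Finset.mem_range]
  constructor
  · rintro ⟨j, hj, rfl⟩
    exact h.dist_last ▸ h.anti j m hj le_rfl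
  · intro hi
    by_contra! hne
    exact absurd (h.outside i m le_rfl (fun j hj => (hne j hj).symm))
      (not_le.2 (h.dist_last ▸ hi))

/-- Apply `Spread.relay_le_of_bound` to the `j` farthest agents of the side: everybody else starts
at distance at most `sideDist pos k σ idx j`. For `j = 0` the left side vanishes by the convention
`relayAcc q 0 = q 0`. -/
theorem acc_sub_le (h : IsSide pos k σ m idx) {x : Fin n → ℝ → ℝ} {Q : ℝ} {τ : Fin n → ℝ}
    {rank : Fin n → ℝ ×ₗ ℕ} (hx : Spread x k Q τ rank) (h0 : ∀ i, x i 0 = σ * (pos i - pos k))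
    {j : ℕ} (hj : j ≤ m) :
    relayAcc (sideDist pos k σ idx) j - sideDist pos k σ idx j ≤ 2 * Q := by
  cases j with
  | zero =>
    have := hx.power_nonneg
    rw [relayAcc]
    linarith
  | succ j =>
    rw [← relay_nearestFirst]
    refine hx.relay_le_of_bound (U := (Finset.range (j + 1)).image idx) (fun hk => ?_)
      (pairwise_nearestFirst h.anti _ hj) (by simp) ?_ (fun i hi => ?_)
    · obtain ⟨i, hi, hik⟩ := Finset.mem_image.1 hk
      rw [Finset.mem_range] at hi
      have := h.injOn (Set.mem_Iic.2 (by omega : i ≤ m)) (Set.mem_Iic.2 le_rfl)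
        (hik.trans h.last.symm)
      omega
    · simp only [h0]
      exact h.map_image hj
    · rw [h0]
      refine h.outside i _ hj (fun j' hj' hij => hi ?_)
      exact hij ▸ Finset.mem_image_of_mem _ (Finset.mem_range.2 hj')

end IsSide

/-! ## The optimal power -/

/-- The power that the agents `0, ..., j - 1` of a side need to carry the information, and at
least `P`. -/
noncomputable def carryPower (q : ℕ → ℝ) (P : ℝ) : ℕ → ℝ
  | 0 => P
  | j + 1 => max (carryPower q P j) ((relayAcc q j - q j) / 2)

theorem le_carryPower (q : ℕ → ℝ) (P : ℝ) (j : ℕ) : P ≤ carryPower q P j := by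
  induction j with
  | zero => exact le_rfl
  | succ j ih => exact ih.trans (le_max_left _ _)

theorem acc_sub_le_carryPower (q : ℕ → ℝ) (P : ℝ) {j m : ℕ} (hj : j < m) :
    relayAcc q j - q j ≤ 2 * carryPower q P m := by
  induction m with
  | zero => omega
  | succ m ih =>
    have h1 : carryPower q P m ≤ carryPower q P (m + 1) := le_max_left _ _
    have h2 : (relayAcc q m - q m) / 2 ≤ carryPower q P (m + 1) := le_max_right _ _
    rcases Nat.lt_succ_iff_lt_or_eq.1 hj with hj | rfl
    · linarith [ih hj]
    · linarith

theorem carryPower_le {q : ℕ → ℝ} {P Q : ℝ} {m : ℕ} (hP : P ≤ Q)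
    (h : ∀ j < m, relayAcc q j - q j ≤ 2 * Q) : carryPower q P m ≤ Q := by
  induction m with
  | zero => exact hP
  | succ m ih =>
    exact max_le (ih fun j hj => h j (by omega)) (by linarith [h m (by omega)])

/-- The power that the source needs if its sides have relay values `c` and `b`. -/
noncomputable def sourcePower (c b : ℝ) : ℝ :=
  max (max c b / 2) ((2 * min c b + max c b) / 4)

/-- The optimal broadcast power, from the distances on both sides of the source. -/
noncomputable def broadcastPower (q : ℕ → ℝ) (m : ℕ) (q' : ℕ → ℝ) (m' : ℕ) : ℝ :=
  max (carryPower q' (carryPower q 0 m) m') (sourcePower (relayAcc q m) (relayAcc q' m'))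

/-- The carrying terms are `acc_sub_le` for `j < m`, the term `max c b / 2` is the case `j = m`,
where the distance is zero. The last term follows from either alternative of `Spread.both_sides`,
because `2 * min c b + max c b` is the smaller of the two sums. -/
theorem broadcastPower_le {x : Fin n → ℝ → ℝ} {Q : ℝ} {τ : Fin n → ℝ} (hpos : pos.Injective)
    {rank : Fin n → ℝ ×ₗ ℕ} (hx : Spread x k Q τ rank) (h0 : ∀ i, x i 0 = pos i)
    {m m' : ℕ} {idx idx' : ℕ → Fin n} (h : IsSide pos k 1 m idx)
    (h' : IsSide pos k (-1) m' idx') :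
    broadcastPower (sideDist pos k 1 idx) m (sideDist pos k (-1) idx') m' ≤ Q := by
  have hy := hx.sub_const (pos k)
  have hy' := hy.neg
  have hQ := hx.power_nonneg
  have key := fun j hj => h.acc_sub_le hy (fun i => by rw [h0, one_mul]) (j := j) hj
  have key' := fun j hj => h'.acc_sub_le hy' (fun i => by rw [h0, neg_one_mul]) (j := j) hj
  have hc := key m le_rfl
  have hb := key' m' le_rfl
  rw [h.dist_last, sub_zero] at hc
  rw [h'.dist_last, sub_zero] at hb
  refine max_le (carryPower_le (carryPower_le hQ fun j hj => key j hj.le)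
    fun j hj => key' j hj.le) (max_le ?_ ?_)
  · linarith [max_le hc hb]
  · have hboth := hy.both_sides (by simp [h0]) (U := (Finset.range m).image idx)
      (V := (Finset.range m').image idx')
      (fun i => by rw [h.mem_image, h0, one_mul])
      (fun i => by rw [h'.mem_image, h0, neg_one_mul, neg_pos])
      (fun i hi => hpos (by rw [h0] at hi; linarith))
      (pairwise_nearestFirst h.anti m le_rfl) (pairwise_nearestFirst h'.anti m' le_rfl)
      (by simpa [h0] using h.map_image le_rfl) (by simpa [h0] using h'.map_image le_rfl)
    rw [h.relay_eq, h'.relay_eq] at hboth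
    have := hboth hc hb
    rcases le_total (relayAcc (sideDist pos k 1 idx) m) (relayAcc (sideDist pos k (-1) idx') m')
      with hle | hle
    · rw [min_eq_left hle, max_eq_right hle]
      rcases this with h | h <;> linarith
    · rw [min_eq_right hle, max_eq_left hle]
      rcases this with h | h <;> linarith

end Side

end LineAgents

namespace LineAgents

variable {n : ℕ}

/-! ## Strategies with two movements of each agent -/

/-- Each agent `i` walks at time `0` to `u i`, and at time `s i` on to `v i`. -/
def twoMoveStrategy (pos u v s : Fin n → ℝ) : Strategy n :=
  (List.finRange n).flatMap fun i => [⟨i, 0, pos i, u i⟩, ⟨i, s i, u i, v i⟩]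

theorem flatMap_ite_eq {α β : Type*} [DecidableEq α] (F : α → List β) (i : α) (l : List α)
    (hl : l.Nodup) :
    (l.flatMap fun j => if j = i then F j else []) = if i ∈ l then F i else [] := by
  induction l with
  | nil => rfl
  | cons a l ih =>
    rw [List.nodup_cons] at hl
    rw [List.flatMap_cons, ih hl.2]
    by_cases h : a = i
    · subst h
      simp [hl.1]
    · simp [h, Ne.symm h]

theorem movesOf_twoMoveStrategy (pos u v s : Fin n → ℝ) (i : Fin n) :
    (twoMoveStrategy pos u v s).movesOf i = [⟨i, 0, pos i, u i⟩, ⟨i, s i, u i, v i⟩] := by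
  rw [Strategy.movesOf, twoMoveStrategy, List.filter_flatMap]
  have : (fun j => List.filter (fun m : Move n => decide (m.agent = i))
      [⟨j, 0, pos j, u j⟩, ⟨j, s j, u j, v j⟩]) =
      fun j => if j = i then [⟨j, 0, pos j, u j⟩, ⟨j, s j, u j, v j⟩] else [] := by
    funext j
    by_cases h : j = i <;> simp [h]
  rw [this, flatMap_ite_eq _ _ _ (List.nodup_finRange n)]
  simp

theorem length_flatMap_pair {α β : Type*} (g h : α → β) (l : List α) :
    (l.flatMap fun a => [g a, h a]).length = 2 * l.length := by
  induction l with
  | nil => rfl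
  | cons a l ih =>
    rw [List.flatMap_cons, List.length_append, ih]
    simp only [List.length_cons, List.length_nil]
    ring

theorem getElem?_flatMap_pair {α β : Type*} (g h : α → β) (l : List α) (j : ℕ) :
    (l.flatMap fun a => [g a, h a])[2 * j]? = l[j]?.map g ∧
      (l.flatMap fun a => [g a, h a])[2 * j + 1]? = l[j]?.map h := by
  induction l generalizing j with
  | nil => simp
  | cons a l ih =>
    cases j with
    | zero => simp
    | succ j => simpa [Nat.mul_add] using ih j

theorem length_twoMoveStrategy (pos u v s : Fin n → ℝ) :
    (twoMoveStrategy pos u v s).length = 2 * n := by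
  rw [twoMoveStrategy, length_flatMap_pair, List.length_finRange]

theorem getElem_twoMoveStrategy_even (pos u v s : Fin n → ℝ) (i : Fin n)
    (h : 2 * (i : ℕ) < (twoMoveStrategy pos u v s).length) :
    (twoMoveStrategy pos u v s)[2 * (i : ℕ)] = ⟨i, 0, pos i, u i⟩ := by
  have := (getElem?_flatMap_pair (fun i => (⟨i, 0, pos i, u i⟩ : Move n))
    (fun i => ⟨i, s i, u i, v i⟩) (List.finRange n) i).1
  rw [← Option.some_inj, ← List.getElem?_eq_getElem, twoMoveStrategy, this]
  simp

theorem getElem_twoMoveStrategy_odd (pos u v s : Fin n → ℝ) (i : Fin n)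
    (h : 2 * (i : ℕ) + 1 < (twoMoveStrategy pos u v s).length) :
    (twoMoveStrategy pos u v s)[2 * (i : ℕ) + 1] = ⟨i, s i, u i, v i⟩ := by
  have := (getElem?_flatMap_pair (fun i => (⟨i, 0, pos i, u i⟩ : Move n))
    (fun i => ⟨i, s i, u i, v i⟩) (List.finRange n) i).2
  rw [← Option.some_inj, ← List.getElem?_eq_getElem, twoMoveStrategy, this]
  simp

theorem distance_twoMoveStrategy (pos u v s : Fin n → ℝ) (i : Fin n) :
    (twoMoveStrategy pos u v s).distance i = |u i - pos i| + |v i - u i| := by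
  simp [Strategy.distance, movesOf_twoMoveStrategy, Move.length]

theorem feasible_twoMoveStrategy {pos u v s : Fin n → ℝ} {ℓ : ℝ}
    (hu : ∀ i, u i ∈ Set.Icc 0 ℓ) (hv : ∀ i, v i ∈ Set.Icc 0 ℓ)
    (hs : ∀ i, |u i - pos i| ≤ s i) : (twoMoveStrategy pos u v s).Feasible ℓ pos := by
  intro i
  rw [movesOf_twoMoveStrategy]
  exact ⟨le_rfl, rfl, hu i, by simpa [Move.length] using hs i, rfl, hv i, trivial⟩

/-- At the very moment when a movement ends, `positionFrom` still evaluates this movement and not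
the tail; hence the two cases. -/
theorem positionFrom_cons_of_le {x t : ℝ} (m : Move n) (L : List (Move n)) (hx : m.src = x)
    (ht : m.start + m.length ≤ t) : positionFrom x (m :: L) t = positionFrom m.dst L t ∨
      (t = m.start + m.length ∧ positionFrom x (m :: L) t = m.dst) := by
  subst hx
  have hlen : m.length = |m.dst - m.src| := rfl
  have hnn := m.length_nonneg
  rcases ht.lt_or_eq with h | h
  · left
    rw [positionFrom, if_neg (by linarith), if_neg (by linarith)]
  · right
    refine ⟨h.symm, ?_⟩
    rw [positionFrom]
    by_cases h1 : t ≤ m.start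
    · rw [if_pos h1]
      have : |m.dst - m.src| = 0 := by linarith
      linarith [abs_eq_zero.1 this]
    · rw [if_neg h1, if_pos h.ge]
      split_ifs with h2
      · rw [abs_of_nonneg (by linarith)] at hlen
        linarith
      · rw [abs_of_neg (by linarith)] at hlen
        linarith

theorem trajectory_twoMoveStrategy_mid (pos u v s : Fin n → ℝ) (i : Fin n) {t : ℝ}
    (h1 : |u i - pos i| ≤ t) (h2 : t ≤ s i) :
    (twoMoveStrategy pos u v s).trajectory pos i t = u i := by
  rw [Strategy.trajectory, movesOf_twoMoveStrategy]
  rcases positionFrom_cons_of_le ⟨i, 0, pos i, u i⟩ [⟨i, s i, u i, v i⟩] (x := pos i) rfl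
    (by simpa [Move.length] using h1) with h | ⟨-, h⟩
  · rw [h, positionFrom, if_pos h2]
  · exact h

theorem trajectory_twoMoveStrategy_end (pos u v s : Fin n → ℝ) (i : Fin n) {t : ℝ}
    (h1 : |u i - pos i| ≤ s i) (h2 : s i + |v i - u i| ≤ t) :
    (twoMoveStrategy pos u v s).trajectory pos i t = v i := by
  have hv := abs_nonneg (v i - u i)
  rw [Strategy.trajectory, movesOf_twoMoveStrategy]
  have hend : positionFrom (u i) [(⟨i, s i, u i, v i⟩ : Move n)] t = v i := by
    rcases positionFrom_cons_of_le ⟨i, s i, u i, v i⟩ [] (x := u i) rfl h2 with h | ⟨-, h⟩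
    · rw [h, positionFrom]
    · exact h
  rcases positionFrom_cons_of_le ⟨i, 0, pos i, u i⟩ [⟨i, s i, u i, v i⟩] (x := pos i) (t := t) rfl
    (by simp only [Move.length, zero_add]; linarith) with h | ⟨ht, h⟩
  · rw [h, hend]
  · rw [h]
    simp only [Move.length, zero_add] at ht
    -- Here the first movement ends only at time `t`, so the second one has length zero.
    have : v i - u i = 0 := abs_eq_zero.1 (by linarith)
    simp only
    linarith

/-! ## The optimal strategy -/

/-- The distance from the source at which the agents `0, ..., j - 1` of a side need the
information. -/
noncomputable def reach (q : ℕ → ℝ) (P : ℝ) (j : ℕ) : ℝ := max (relayAcc q j - P) 0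

theorem reach_nonneg (q : ℕ → ℝ) (P : ℝ) (j : ℕ) : 0 ≤ reach q P j := le_max_right _ _

variable {pos : Fin n → ℝ} {k : Fin n}

/-- On this side, each agent walks to the place where it gets the information, and then carries
it to the next agent. -/
structure IsRelayPlan (pos : Fin n → ℝ) (k : Fin n) (σ : ℝ) (m : ℕ) (idx : ℕ → Fin n)
    (P D : ℝ) (u v s : Fin n → ℝ) : Prop where
  pickup : ∀ j < m, u (idx j) = pos k + σ * reach (sideDist pos k σ idx) P (j + 1)
  handover : ∀ j < m, v (idx j) = pos k + σ * reach (sideDist pos k σ idx) P j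
  start : ∀ j < m, s (idx j) = D + D + reach (sideDist pos k σ idx) P (j + 1)

namespace IsSide

variable {σ : ℝ} {m : ℕ} {idx : ℕ → Fin n}

theorem pos_eq (h : IsSide pos k σ m idx) (j : ℕ) :
    pos (idx j) = pos k + σ * sideDist pos k σ idx j := by
  rcases h.sign with rfl | rfl <;> simp [sideDist]

theorem abs_sub (h : IsSide pos k σ m idx) (a b : ℝ) :
    |(pos k + σ * a) - (pos k + σ * b)| = |a - b| := by
  rw [add_sub_add_left_eq_sub, ← mul_sub, abs_mul]
  rcases h.sign with rfl | rfl <;> simp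

variable {P : ℝ}

theorem reach_succ_le (h : IsSide pos k σ m idx) {j : ℕ} (hj : j ≤ m) :
    reach (sideDist pos k σ idx) P (j + 1) ≤ reach (sideDist pos k σ idx) P j :=
  max_le_max (sub_le_sub_right (h.acc_succ_le hj) P) le_rfl

/-- The carrying bound on `P` says precisely that agent `j` never has to fetch the information
beyond its own starting point. -/
theorem reach_succ_le_dist (h : IsSide pos k σ m idx) {j : ℕ} (hj : j ≤ m)
    (hP : relayAcc (sideDist pos k σ idx) j - sideDist pos k σ idx j ≤ 2 * P) :
    reach (sideDist pos k σ idx) P (j + 1) ≤ sideDist pos k σ idx j := by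
  refine max_le ?_ (h.dist_nonneg hj)
  rw [relayAcc]
  linarith

theorem reach_le (h : IsSide pos k σ m idx) (hP : 0 ≤ P) {j : ℕ} (hj : j ≤ m) :
    reach (sideDist pos k σ idx) P j ≤ sideDist pos k σ idx 0 :=
  max_le (by linarith [h.acc_le hj]) (h.dist_nonneg (Nat.zero_le m))

theorem dist_le (h : IsSide pos k σ m idx) {j : ℕ} (hj : j ≤ m) :
    sideDist pos k σ idx j ≤ sideDist pos k σ idx 0 :=
  (h.dist_le_acc hj).trans (h.acc_le hj)

/-- If the place of delivery is not cut off at zero, this is the recursion for `relayAcc`. If it is,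
nothing is left to deliver, and `sideDist` is at most `relayAcc`, hence at most `P`. -/
theorem cost_le (h : IsSide pos k σ m idx) {j : ℕ} (hj : j ≤ m) :
    (sideDist pos k σ idx j - reach (sideDist pos k σ idx) P (j + 1)) +
      (reach (sideDist pos k σ idx) P j - reach (sideDist pos k σ idx) P (j + 1)) ≤ P := by
  have h1 : relayAcc (sideDist pos k σ idx) (j + 1) - P ≤
    reach (sideDist pos k σ idx) P (j + 1) := le_max_left _ _
  have h2 := reach_nonneg (sideDist pos k σ idx) P (j + 1)
  have h3 := h.dist_le_acc hj
  rw [relayAcc] at h1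
  rcases max_choice (relayAcc (sideDist pos k σ idx) j - P) 0 with h4 | h4 <;>
    rw [← reach.eq_1] at h4
  · linarith
  · have : relayAcc (sideDist pos k σ idx) j - P ≤ reach (sideDist pos k σ idx) P j :=
      le_max_left _ _
    linarith

theorem mem_Icc (h : IsSide pos k σ m idx) {ℓ : ℝ} (hpos : ∀ i, pos i ∈ Set.Icc 0 ℓ) {a : ℝ}
    (h0 : 0 ≤ a) (ha : a ≤ sideDist pos k σ idx 0) : pos k + σ * a ∈ Set.Icc 0 ℓ := by
  have h1 := hpos k
  have h2 := hpos (idx 0)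
  rw [h.pos_eq 0] at h2
  rw [Set.mem_Icc] at h1 h2 ⊢
  rcases h.sign with hσ | hσ <;> rw [hσ] at h2 ha ⊢ <;> constructor <;> linarith

variable {u v s : Fin n → ℝ} {D : ℝ}

theorem plan_abs (h : IsSide pos k σ m idx) (hp : IsRelayPlan pos k σ m idx P D u v s)
    (hP : ∀ j ≤ m, relayAcc (sideDist pos k σ idx) j - sideDist pos k σ idx j ≤ 2 * P)
    {j : ℕ} (hj : j < m) :
    |u (idx j) - pos (idx j)| =
        sideDist pos k σ idx j - reach (sideDist pos k σ idx) P (j + 1) ∧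
      |v (idx j) - u (idx j)| =
        reach (sideDist pos k σ idx) P j - reach (sideDist pos k σ idx) P (j + 1) := by
  rw [hp.pickup j hj, hp.handover j hj, h.pos_eq j, h.abs_sub, h.abs_sub]
  refine ⟨?_, abs_of_nonneg (sub_nonneg.2 (h.reach_succ_le hj.le))⟩
  rw [abs_sub_comm]
  exact abs_of_nonneg (sub_nonneg.2 (h.reach_succ_le_dist hj.le (hP j hj.le)))

/-- If the source appears at the right place in time, then the whole side gets informed. -/
theorem informed (h : IsSide pos k σ m idx) (hp : IsRelayPlan pos k σ m idx P D u v s)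
    (hP : ∀ j ≤ m, relayAcc (sideDist pos k σ idx) j - sideDist pos k σ idx j ≤ 2 * P)
    (hD : sideDist pos k σ idx 0 ≤ D) {t : ℝ} (hDt : D ≤ t) (htD : t ≤ D + D)
    (hk : (twoMoveStrategy pos u v s).trajectory pos k t =
      pos k + σ * reach (sideDist pos k σ idx) P m) {j : ℕ} (hj : j < m) :
    ∃ t, Informed ((twoMoveStrategy pos u v s).trajectory pos) k (idx j) t := by
  have hD0 : 0 ≤ D := (h.dist_nonneg (Nat.zero_le m)).trans hD
  have habs : ∀ j < m, |u (idx j) - pos (idx j)| ≤ D := fun j hj => by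
    rw [(h.plan_abs hp hP hj).1]
    linarith [h.dist_le hj.le, reach_nonneg (sideDist pos k σ idx) P (j + 1)]
  have key : ∀ d j, j + 1 + d = m →
      Informed ((twoMoveStrategy pos u v s).trajectory pos) k (idx j)
        (D + D + reach (sideDist pos k σ idx) P (j + 1)) := by
    intro d
    induction d with
    | zero =>
      intro j hjm
      have hjm' : j < m := by omega
      have hr := reach_nonneg (sideDist pos k σ idx) P (j + 1)
      refine Informed.keep _ t _ (Informed.meet _ k _ (Informed.source _ (hD0.trans hDt)) ?_)
        (by linarith)
      rw [hk, trajectory_twoMoveStrategy_mid pos u v s (idx j) ((habs j hjm').trans hDt)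
        (by rw [hp.start j hjm']; linarith), hp.pickup j hjm', ← hjm]
    | succ d ih =>
      intro j hjm
      have hj1 : j < m := by omega
      have hj2 : j + 1 < m := by omega
      have hr := reach_nonneg (sideDist pos k σ idx) P (j + 1)
      have hr' := reach_nonneg (sideDist pos k σ idx) P (j + 1 + 1)
      refine Informed.meet _ (idx (j + 1)) _ (Informed.keep _ _ _ (ih (j + 1) (by omega))
        (by linarith [h.reach_succ_le (P := P) hj2.le])) ?_
      rw [trajectory_twoMoveStrategy_mid pos u v s (idx j) (by linarith [habs j hj1])
        (hp.start j hj1).ge, trajectory_twoMoveStrategy_end pos u v s (idx (j + 1))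
        (by rw [hp.start _ hj2]; linarith [habs _ hj2])
        (by rw [hp.start _ hj2, (h.plan_abs hp hP hj2).2]; linarith),
        hp.pickup j hj1, hp.handover _ hj2]
  exact ⟨_, key (m - (j + 1)) j (by omega)⟩

theorem exists_idx (h : IsSide pos k 1 m idx) {m' : ℕ} {idx' : ℕ → Fin n}
    (h' : IsSide pos k (-1) m' idx') (hpos : pos.Injective) (i : Fin n) :
    i = k ∨ (∃ j < m, i = idx j) ∨ ∃ j < m', i = idx' j := by
  by_contra! hi
  obtain ⟨h1, h2, h3⟩ := hi
  have h4 := h.outside i m le_rfl h2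
  have h5 := h'.outside i m' le_rfl h3
  rw [h.dist_last] at h4
  rw [h'.dist_last] at h5
  exact h1 (hpos (by linarith))

theorem source_ne (h : IsSide pos k σ m idx) {j : ℕ} (hj : j < m) : k ≠ idx j := fun hk => by
  have := h.injOn (Set.mem_Iic.2 hj.le) (Set.mem_Iic.2 le_rfl) (hk.symm.trans h.last.symm)
  omega

theorem idx_ne (h : IsSide pos k 1 m idx) {m' : ℕ} {idx' : ℕ → Fin n}
    (h' : IsSide pos k (-1) m' idx') {j j' : ℕ} (hj : j < m) (hj' : j' < m') :
    idx j ≠ idx' j' := fun he => by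
  have h1 := h.anti j m hj le_rfl
  have h2 := h'.anti j' m' hj' le_rfl
  rw [h.dist_last, sideDist] at h1
  rw [h'.dist_last, sideDist, ← he] at h2
  linarith

end IsSide

/-- The movements of the source: it visits first the side with the smaller relay value. -/
structure IsSourcePlan (pos : Fin n → ℝ) (k : Fin n) (c b P D : ℝ) (u v s : Fin n → ℝ) :
    Prop where
  first : u k = if c ≤ b then pos k + max (c - P) 0 else pos k - max (b - P) 0
  second : v k = if c ≤ b then pos k - max (b - P) 0 else pos k + max (c - P) 0
  start : s k = D

/-- With two genuine visits the condition is `2 * c + b ≤ 4 * P`; with only the visit on the side of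
`b` it is `b ≤ 2 * P`. These are the two terms of `sourcePower`. -/
theorem source_cost {c b P : ℝ} (hP : 0 ≤ P) (h : sourcePower c b ≤ P) (hcb : c ≤ b) :
    2 * max (c - P) 0 + max (b - P) 0 ≤ P := by
  have h1 := (le_max_left _ _).trans h
  have h2 := (le_max_right _ _).trans h
  rw [min_eq_left hcb, max_eq_right hcb] at h2
  rw [max_eq_right hcb] at h1
  rcases max_cases (c - P) 0 with ⟨h3, h4⟩ | ⟨h3, h4⟩ <;>
    rcases max_cases (b - P) 0 with ⟨h5, h6⟩ | ⟨h5, h6⟩ <;> rw [h3, h5] <;> linarith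

theorem sourcePower_comm (c b : ℝ) : sourcePower c b = sourcePower b c := by
  rw [sourcePower, sourcePower, max_comm c b, min_comm c b]

theorem twoMoveStrategy_optimal {ℓ : ℝ} (hpos : IsConfiguration ℓ pos)
    {m m' : ℕ} {idx idx' : ℕ → Fin n} (h : IsSide pos k 1 m idx)
    (h' : IsSide pos k (-1) m' idx') {P D : ℝ} {u v s : Fin n → ℝ}
    (hP : P = broadcastPower (sideDist pos k 1 idx) m (sideDist pos k (-1) idx') m')
    (hD : D = sideDist pos k 1 idx 0 + sideDist pos k (-1) idx' 0)
    (hp : IsRelayPlan pos k 1 m idx P D u v s) (hp' : IsRelayPlan pos k (-1) m' idx' P D u v s)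
    (hk : IsSourcePlan pos k (relayAcc (sideDist pos k 1 idx) m)
      (relayAcc (sideDist pos k (-1) idx') m') P D u v s) :
    (twoMoveStrategy pos u v s).IsBroadcast ℓ pos k ∧
      (twoMoveStrategy pos u v s).UsesPowerAtMost P := by
  set q := sideDist pos k 1 idx with hq
  set q' := sideDist pos k (-1) idx' with hq'
  have hcarry' : carryPower q' (carryPower q 0 m) m' ≤ P := hP ▸ le_max_left _ _
  have hcarry : carryPower q 0 m ≤ P := (le_carryPower _ _ _).trans hcarry'
  have hP0 : 0 ≤ P := (le_carryPower _ _ _).trans hcarry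
  have hsource : sourcePower (relayAcc q m) (relayAcc q' m') ≤ P := hP ▸ le_max_right _ _
  have hmax : max (relayAcc q m) (relayAcc q' m') / 2 ≤ P := (le_max_left _ _).trans hsource
  -- The carrying power covers `j < m`; for `j = m` the distance is zero and `sourcePower` supplies
  -- the bound.
  have hb : ∀ j ≤ m, relayAcc q j - q j ≤ 2 * P := fun j hj => by
    rcases hj.lt_or_eq with hj | rfl
    · linarith [acc_sub_le_carryPower q 0 hj]
    · linarith [h.dist_last, le_max_left (relayAcc q j) (relayAcc q' m')]
  have hb' : ∀ j ≤ m', relayAcc q' j - q' j ≤ 2 * P := fun j hj => by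
    rcases hj.lt_or_eq with hj | rfl
    · linarith [acc_sub_le_carryPower q' (carryPower q 0 m) hj]
    · linarith [h'.dist_last, le_max_right (relayAcc q m) (relayAcc q' j)]
  have hq0 : 0 ≤ q 0 := h.dist_nonneg (Nat.zero_le m)
  have hq0' : 0 ≤ q' 0 := h'.dist_nonneg (Nat.zero_le m')
  have hr0 : 0 ≤ reach q P m := reach_nonneg q P m
  have hr0' : 0 ≤ reach q' P m' := reach_nonneg q' P m'
  have hr : reach q P m ≤ q 0 := h.reach_le hP0 le_rfl
  have hr' : reach q' P m' ≤ q' 0 := h'.reach_le hP0 le_rfl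
  have hcover := fun i => h.exists_idx h' hpos.1.injective i
  have hsrc : |u k - pos k| + |v k - u k| ≤ P ∧ |u k - pos k| ≤ D ∧ |v k - u k| ≤ D ∧
      u k ∈ Set.Icc 0 ℓ ∧ v k ∈ Set.Icc 0 ℓ ∧
      ((u k = pos k + 1 * reach q P m ∧ v k = pos k + -1 * reach q' P m') ∨
        (v k = pos k + 1 * reach q P m ∧ u k = pos k + -1 * reach q' P m')) := by
    have e1 : pos k + max (relayAcc q m - P) 0 = pos k + 1 * reach q P m := by
      rw [one_mul, reach]
    have e2 : pos k - max (relayAcc q' m' - P) 0 = pos k + -1 * reach q' P m' := by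
      rw [neg_one_mul, reach, sub_eq_add_neg]
    have i1 := h.mem_Icc hpos.2 hr0 hr
    have i2 := h'.mem_Icc hpos.2 hr0' hr'
    have huk := hk.first
    have hvk := hk.second
    rw [e1, e2] at huk hvk
    by_cases hcb : relayAcc q m ≤ relayAcc q' m'
    · rw [if_pos hcb] at huk hvk
      have := source_cost hP0 hsource hcb
      rw [← reach.eq_1, ← reach.eq_1] at this
      rw [huk, hvk]
      refine ⟨?_, ?_, ?_, i1, i2, Or.inl ⟨rfl, rfl⟩⟩
      · rw [abs_of_nonneg (by linarith), abs_of_nonpos (by linarith)]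
        linarith
      · rw [abs_of_nonneg (by linarith)]
        linarith
      · rw [abs_of_nonpos (by linarith)]
        linarith
    · rw [if_neg hcb] at huk hvk
      have := source_cost hP0 (sourcePower_comm _ _ ▸ hsource) (le_of_not_ge hcb)
      rw [← reach.eq_1, ← reach.eq_1] at this
      rw [huk, hvk]
      refine ⟨?_, ?_, ?_, i2, i1, Or.inr ⟨rfl, rfl⟩⟩
      · rw [abs_of_nonpos (by linarith), abs_of_nonneg (by linarith)]
        linarith
      · rw [abs_of_nonpos (by linarith)]
        linarith
      · rw [abs_of_nonneg (by linarith)]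
        linarith
  obtain ⟨hcost, hu1, hv1, huI, hvI, hplace⟩ := hsrc
  have hD0 : 0 ≤ D := (abs_nonneg _).trans hu1
  have hall : ∀ i, |u i - pos i| + |v i - u i| ≤ P ∧ |u i - pos i| ≤ s i ∧
      u i ∈ Set.Icc 0 ℓ ∧ v i ∈ Set.Icc 0 ℓ := fun i => by
    rcases hcover i with rfl | ⟨j, hj, rfl⟩ | ⟨j, hj, rfl⟩
    · exact ⟨hcost, hk.start ▸ hu1, huI, hvI⟩
    · obtain ⟨h1, h2⟩ := h.plan_abs hp hb hj
      rw [h1, h2, hp.start j hj, hp.pickup j hj, hp.handover j hj]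
      have := reach_nonneg q P (j + 1)
      exact ⟨h.cost_le hj.le, by linarith [h.dist_le hj.le],
        h.mem_Icc hpos.2 (reach_nonneg _ _ _) (h.reach_le hP0 hj),
        h.mem_Icc hpos.2 (reach_nonneg _ _ _) (h.reach_le hP0 hj.le)⟩
    · obtain ⟨h1, h2⟩ := h'.plan_abs hp' hb' hj
      rw [h1, h2, hp'.start j hj, hp'.pickup j hj, hp'.handover j hj]
      have := reach_nonneg q' P (j + 1)
      exact ⟨h'.cost_le hj.le, by linarith [h'.dist_le hj.le],
        h'.mem_Icc hpos.2 (reach_nonneg _ _ _) (h'.reach_le hP0 hj),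
        h'.mem_Icc hpos.2 (reach_nonneg _ _ _) (h'.reach_le hP0 hj.le)⟩
  have hmid : (twoMoveStrategy pos u v s).trajectory pos k D = u k :=
    trajectory_twoMoveStrategy_mid pos u v s k hu1 hk.start.ge
  have hend : (twoMoveStrategy pos u v s).trajectory pos k (D + D) = v k :=
    trajectory_twoMoveStrategy_end pos u v s k (hk.start ▸ hu1) (by rw [hk.start]; linarith)
  have hright : ∃ t, D ≤ t ∧ t ≤ D + D ∧
      (twoMoveStrategy pos u v s).trajectory pos k t = pos k + 1 * reach q P m := by
    rcases hplace with ⟨h1, -⟩ | ⟨h1, -⟩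
    · exact ⟨D, le_rfl, by linarith, hmid.trans h1⟩
    · exact ⟨D + D, by linarith, le_rfl, hend.trans h1⟩
  have hleft : ∃ t, D ≤ t ∧ t ≤ D + D ∧
      (twoMoveStrategy pos u v s).trajectory pos k t = pos k + -1 * reach q' P m' := by
    rcases hplace with ⟨-, h1⟩ | ⟨-, h1⟩
    · exact ⟨D + D, by linarith, le_rfl, hend.trans h1⟩
    · exact ⟨D, le_rfl, by linarith, hmid.trans h1⟩
  refine ⟨⟨feasible_twoMoveStrategy (fun i => (hall i).2.2.1) (fun i => (hall i).2.2.2)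
    (fun i => (hall i).2.1), fun i => ?_⟩, fun i => ?_⟩
  · rcases hcover i with rfl | ⟨j, hj, rfl⟩ | ⟨j, hj, rfl⟩
    · exact ⟨0, Informed.source 0 le_rfl⟩
    · obtain ⟨t, h1, h2, h3⟩ := hright
      exact h.informed hp hb (by linarith) h1 h2 h3 hj
    · obtain ⟨t, h1, h2, h3⟩ := hleft
      exact h'.informed hp' hb' (by linarith) h1 h2 h3 hj
  · rw [distance_twoMoveStrategy]
    exact (hall i).1

theorem isOptimalBroadcastPower {ℓ : ℝ} (hpos : IsConfiguration ℓ pos)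
    {m m' : ℕ} {idx idx' : ℕ → Fin n} (h : IsSide pos k 1 m idx)
    (h' : IsSide pos k (-1) m' idx') {S : Strategy n} (hS : S.IsBroadcast ℓ pos k)
    (hSP : S.UsesPowerAtMost
      (broadcastPower (sideDist pos k 1 idx) m (sideDist pos k (-1) idx') m')) :
    IsOptimalBroadcastPower ℓ pos k
      (broadcastPower (sideDist pos k 1 idx) m (sideDist pos k (-1) idx') m') := by
  refine ⟨⟨S, hS, hSP⟩, ?_⟩
  rintro Q ⟨S', hS', hQ⟩
  obtain ⟨h0, τ, rank, hx⟩ := hS'.exists_spread hQ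
  exact broadcastPower_le hpos.1.injective hx h0 h h'

end LineAgents

namespace RealRAM

/-! ## Structured programs -/

/-- The same state with another program counter. -/
def State.goto (s : State) (l : ℕ) : State := { s with pc := l }

/-- The machine gets from `s` to `s'` in at most `T` steps. -/
def Reaches (p : Program) (s : State) (T : ℕ) (s' : State) : Prop :=
  ∃ t ≤ T, run p t s = some s'

theorem Reaches.refl (p : Program) (s : State) (T : ℕ) : Reaches p s T s := ⟨0, T.zero_le, rfl⟩

theorem Reaches.step {p : Program} {s s' s'' : State} {T : ℕ} (h : RealRAM.step p s = some s')
    (h' : Reaches p s' T s'') : Reaches p s (T + 1) s'' := by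
  obtain ⟨t, ht, hr⟩ := h'
  exact ⟨t + 1, by omega, by rw [run, h]; exact hr⟩

theorem Reaches.mono {p : Program} {s s' : State} {T T' : ℕ} (h : Reaches p s T s')
    (hT : T ≤ T') : Reaches p s T' s' := by
  obtain ⟨t, ht, hr⟩ := h
  exact ⟨t, ht.trans hT, hr⟩

theorem Reaches.trans {p : Program} {s' s'' : State} {T T' : ℕ} {s : State}
    (h : Reaches p s T s') (h' : Reaches p s' T' s'') : Reaches p s (T + T') s'' := by
  obtain ⟨t, ht, hr⟩ := h
  induction t generalizing s T with
  | zero =>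
    simp only [run, Option.some.injEq] at hr
    subst hr
    exact h'.mono (by omega)
  | succ t ih =>
    rw [run, Option.bind_eq_some_iff] at hr
    obtain ⟨s₁, h1, h2⟩ := hr
    exact (Reaches.step h1 (ih le_rfl h2)).mono (by omega)

/-- The instructions `L` stand in the program `p` from line `l` on. -/
def CodeAt (p : Program) (l : ℕ) (L : List Instr) : Prop :=
  ∀ j i, L[j]? = some i → p[l + j]? = some i

theorem CodeAt.left {p : Program} {l : ℕ} {L L' : List Instr} (h : CodeAt p l (L ++ L')) :
    CodeAt p l L := fun j i hj => h j i (by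
  rw [List.getElem?_append_left (List.getElem?_eq_some_iff.1 hj).1, hj])

theorem CodeAt.right {p : Program} {l : ℕ} {L L' : List Instr} (h : CodeAt p l (L ++ L')) :
    CodeAt p (l + L.length) L' := fun j i hj => by
  rw [add_assoc]
  exact h (L.length + j) i (by rw [List.getElem?_append_right (by omega), ← hj]; congr 1; omega)

theorem CodeAt.step {p : Program} {l : ℕ} {L : List Instr} (h : CodeAt p l L) {j : ℕ} {i : Instr}
    (hj : L[j]? = some i) (s : State) :
    RealRAM.step p (s.goto (l + j)) = exec (s.goto (l + j)) i := by
  simp [RealRAM.step, State.goto, h j i hj]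

theorem CodeAt.step_zero {p : Program} {l : ℕ} {L : List Instr} (h : CodeAt p l L) {i : Instr}
    (hi : L[0]? = some i) (s : State) : RealRAM.step p (s.goto l) = exec (s.goto l) i :=
  h.step hi s

/-- Instructions without division that do not jump. -/
def Instr.isStraight : Instr → Bool
  | .rdiv _ _ _ | .jump _ | .jumpIfIntLe _ _ _ | .jumpIfRealLe _ _ _ | .halt => false
  | _ => true

/-- A straight instruction, or the assignment of the real register `e` to `d` unless
`a ≤ b` holds for the real registers `a`, `b`. -/
inductive Stmt
  | op (i : Instr)
  | cmov (a b d e : ℕ)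

/-- The effect of a statement, apart from the program counter. -/
noncomputable def Stmt.eval (s : State) : Stmt → State
  -- The default is irrelevant for straight instructions: `exec` fails only on `rdiv` and `halt`.
  -- Keeping the program counter makes the meaning of a block independent of its line.
  | .op i => ((exec s i).getD s).goto s.pc
  | .cmov a b d e => { s with
      rreg := Function.update s.rreg d (if s.rreg a ≤ s.rreg b then s.rreg d else s.rreg e) }

def Stmt.isStraight : Stmt → Bool
  | .op i => i.isStraight
  | .cmov _ _ _ _ => true

/-- The instructions of a statement at line `l`. -/
def Stmt.compile (l : ℕ) : Stmt → List Instr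
  | .op i => [i]
  | .cmov a b d e => [.jumpIfRealLe a b (l + 2), .rmov d e]

abbrev Block := List Stmt

noncomputable def evalBlock (B : Block) (s : State) : State := B.foldl Stmt.eval s

def compileBlock : ℕ → Block → List Instr
  | _, [] => []
  | l, c :: B => c.compile l ++ compileBlock (l + (c.compile l).length) B

theorem evalBlock_append (B B' : Block) (s : State) :
    evalBlock (B ++ B') s = evalBlock B' (evalBlock B s) := List.foldl_append

theorem Stmt.reaches {p : Program} {l : ℕ} {c : Stmt} (hc : c.isStraight)
    (h : CodeAt p l (c.compile l)) (s : State) :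
    Reaches p (s.goto l) 2 ((c.eval s).goto (l + (c.compile l).length)) := by
  cases c with
  | op i =>
    refine (Reaches.step (s' := ((Stmt.op i).eval s).goto (l + 1)) ?_
      (Reaches.refl _ _ 0)).mono (by omega)
    rw [h.step_zero rfl s]
    cases i <;> first | exact absurd hc Bool.false_ne_true | rfl
  | cmov a b d e =>
    have h0 := h.step_zero rfl s
    have h1 := h.step (j := 1) rfl s
    by_cases hab : s.rreg a ≤ s.rreg b
    · refine (Reaches.step (s' := s.goto (l + 2)) ?_ ?_ : Reaches p _ (1 + 1) _)
      · rw [h0]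
        simp [exec, State.goto, hab]
      · simp only [Stmt.eval, if_pos hab, Function.update_eq_self]
        exact Reaches.refl _ _ _
    · refine (Reaches.step (s' := s.goto (l + 1)) ?_ (Reaches.step (T := 0)
        (s' := ((Stmt.cmov a b d e).eval s).goto (l + 2)) ?_ (Reaches.refl _ _ _)))
      · rw [h0]
        simp [exec, State.goto, hab]
      · rw [h1]
        simp [exec, State.goto, State.setR, Stmt.eval, hab]

theorem reaches_block {p : Program} (B : Block) : ∀ {l : ℕ}, (∀ c ∈ B, c.isStraight) →
    CodeAt p l (compileBlock l B) → ∀ s : State,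
    Reaches p (s.goto l) (2 * B.length)
      ((evalBlock B s).goto (l + (compileBlock l B).length)) := by
  induction B with
  | nil => intro l _ _ s; exact Reaches.refl _ _ _
  | cons c B ih =>
    intro l hB h s
    have h1 := Stmt.reaches (hB c List.mem_cons_self) h.left s
    have h2 := ih (fun c' hc' => hB c' (List.mem_cons_of_mem _ hc')) h.right (c.eval s)
    rw [compileBlock, List.length_append, ← add_assoc]
    exact (h1.trans h2).mono (by rw [List.length_cons]; omega)

/-- A block, or the repetition of a block for which the integer register `4` is the counter. The
integer register `8` is used for testing and decreasing the counter. -/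
inductive Phase
  | block (B : Block)
  | rep (B : Block)

/-- The body of a repetition, including the treatment of the counter. -/
def repBlock (B : Block) : Block :=
  .op (.iconst 8 0) :: (B ++ [.op (.iconst 8 1), .op (.isub 4 4 8)])

/-- The counter on entry fixes the number of rounds. The final `iconst 8 0` belongs to the last
test, the one that leaves the loop. -/
noncomputable def Phase.eval (s : State) : Phase → State
  | .block B => evalBlock B s
  | .rep B => (Stmt.op (.iconst 8 0)).eval ((evalBlock (repBlock B))^[s.ireg 4] s)

def Phase.compile (l : ℕ) : Phase → List Instr
  | .block B => compileBlock l B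
  | .rep B =>
      [.iconst 8 0, .jumpIfIntLe 4 8
        (l + 3 + (compileBlock (l + 2) (B ++ [.op (.iconst 8 1), .op (.isub 4 4 8)])).length)] ++
      (compileBlock (l + 2) (B ++ [.op (.iconst 8 1), .op (.isub 4 4 8)]) ++ [.jump l])

def Phase.IsStraight : Phase → Prop
  | .block B => ∀ c ∈ B, c.isStraight
  | .rep B => (∀ c ∈ B, c.isStraight) ∧ ∀ s, (evalBlock B s).ireg 4 = s.ireg 4

/-- A statement takes at most two steps. A round consists of two steps for the test, the block, two
further statements for the counter and the jump back: `2 + 2 * B.length + 4 + 1`. The last test adds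
`2`. -/
def Phase.cost (s : State) : Phase → ℕ
  | .block B => 2 * B.length
  | .rep B => (2 * B.length + 7) * s.ireg 4 + 2

theorem ireg_four_repBlock {B : Block} (hB : ∀ s, (evalBlock B s).ireg 4 = s.ireg 4) (s : State) :
    (evalBlock (repBlock B) s).ireg 4 = s.ireg 4 - 1 := by
  have : evalBlock (repBlock B) s = evalBlock [.op (.iconst 8 1), .op (.isub 4 4 8)]
      (evalBlock B ((Stmt.op (.iconst 8 0)).eval s)) := by
    rw [← evalBlock_append]
    rfl
  rw [this]
  simp [evalBlock, Stmt.eval, exec, State.setI, State.goto] at hB ⊢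
  rw [hB]
  simp

theorem Phase.reaches {p : Program} {l : ℕ} {φ : Phase} (hφ : φ.IsStraight)
    (h : CodeAt p l (φ.compile l)) (s : State) :
    Reaches p (s.goto l) (φ.cost s) ((φ.eval s).goto (l + (φ.compile l).length)) := by
  cases φ with
  | block B => exact reaches_block B hφ h s
  | rep B =>
    obtain ⟨hst, h4⟩ := hφ
    set B' : Block := B ++ [.op (.iconst 8 1), .op (.isub 4 4 8)] with hB'
    have hst' : ∀ c ∈ B', c.isStraight := by
      intro c hc
      rw [hB', List.mem_append] at hc
      rcases hc with hc | hc
      · exact hst c hc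
      · simp only [List.mem_cons, List.not_mem_nil, or_false] at hc
        rcases hc with rfl | rfl <;> rfl
    have hhead := h.left
    have hbody : CodeAt p (l + 2) (compileBlock (l + 2) B') := h.right.left
    have hjump : CodeAt p (l + 2 + (compileBlock (l + 2) B').length) [.jump l] := h.right.right
    have hlen : ((Phase.rep B).compile l).length = 3 + (compileBlock (l + 2) B').length := by
      simp only [Phase.compile, List.length_append, List.length_cons, List.length_nil, ← hB']
      omega
    rw [hlen]
    induction hn : s.ireg 4 generalizing s with
    | zero =>
      simp only [Phase.eval, Phase.cost, hn, Function.iterate_zero, id_eq]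
      refine (Reaches.step (s' := ((Stmt.op (.iconst 8 0)).eval s).goto (l + 1)) ?_
        (Reaches.step (T := 0) (s' := ((Stmt.op (.iconst 8 0)).eval s).goto
          (l + (3 + (compileBlock (l + 2) B').length))) ?_ (Reaches.refl _ _ _))).mono (by omega)
      · rw [hhead.step_zero rfl s]
        rfl
      · rw [hhead.step (j := 1) rfl _]
        simp [exec, State.goto, Stmt.eval, State.setI, hn, ← hB']
        omega
    | succ d ih =>
      have hs' : (evalBlock (repBlock B) s).ireg 4 = d := by
        rw [ireg_four_repBlock h4, hn]
        rfl
      have hrest := ih _ hs'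
      have heval : (Phase.rep B).eval (evalBlock (repBlock B) s) = (Phase.rep B).eval s := by
        simp only [Phase.eval, hs', hn, Function.iterate_succ_apply]
      rw [heval] at hrest
      have hloop := reaches_block B' hst' hbody ((Stmt.op (.iconst 8 0)).eval s)
      have hback : Reaches p ((evalBlock B' ((Stmt.op (.iconst 8 0)).eval s)).goto
          (l + 2 + (compileBlock (l + 2) B').length)) 1
          ((evalBlock (repBlock B) s).goto l) := by
        refine Reaches.step (T := 0) ?_ (Reaches.refl _ _ _)
        rw [hjump.step_zero rfl _]
        rfl
      refine (Reaches.step (s' := ((Stmt.op (.iconst 8 0)).eval s).goto (l + 1)) ?_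
        (Reaches.step (s' := ((Stmt.op (.iconst 8 0)).eval s).goto (l + 2)) ?_
          (hloop.trans (hback.trans hrest)))).mono ?_
      · rw [hhead.step_zero rfl s]
        rfl
      · rw [hhead.step (j := 1) rfl _]
        simp [exec, State.goto, Stmt.eval, State.setI, hn]
      · simp only [Phase.cost, hs', hn, hB', List.length_append, List.length_cons,
          List.length_nil]
        have := Nat.mul_add_one (2 * B.length + 7) d
        omega

def compilePhases : ℕ → List Phase → List Instr
  | _, [] => []
  | l, φ :: Φ => φ.compile l ++ compilePhases (l + (φ.compile l).length) Φ

noncomputable def evalPhases (Φ : List Phase) (s : State) : State := Φ.foldl Phase.eval s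

noncomputable def costPhases : List Phase → State → ℕ
  | [], _ => 0
  | φ :: Φ, s => φ.cost s + costPhases Φ (φ.eval s)

theorem reaches_phases {p : Program} (Φ : List Phase) : ∀ {l : ℕ}, (∀ φ ∈ Φ, φ.IsStraight) →
    CodeAt p l (compilePhases l Φ) → ∀ s : State,
    Reaches p (s.goto l) (costPhases Φ s)
      ((evalPhases Φ s).goto (l + (compilePhases l Φ).length)) := by
  induction Φ with
  | nil => intro l _ _ s; exact Reaches.refl _ _ _
  | cons φ Φ ih =>
    intro l hΦ h s
    have h1 := Phase.reaches (hΦ φ List.mem_cons_self) h.left s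
    have h2 := ih (fun φ' hφ' => hΦ φ' (List.mem_cons_of_mem _ hφ')) h.right (φ.eval s)
    rw [compilePhases, List.length_append, ← add_assoc]
    exact h1.trans h2

/-- The program of a list of phases halts in time. -/
theorem haltsWithin_phases {Φ : List Phase} (hΦ : ∀ φ ∈ Φ, φ.IsStraight) {s : State}
    (hs : s.pc = 0) {T : ℕ} (hT : costPhases Φ s ≤ T) :
    HaltsWithin (compilePhases 0 Φ ++ [.halt]) s T
      ((evalPhases Φ s).goto (compilePhases 0 Φ).length) := by
  have h0 : CodeAt (compilePhases 0 Φ ++ [.halt]) 0 (compilePhases 0 Φ ++ [.halt]) :=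
    fun j i hj => by rwa [zero_add]
  obtain ⟨t, ht, hr⟩ := reaches_phases Φ hΦ h0.left s
  have hs0 : s.goto 0 = s := by
    cases s
    simp only [State.goto] at *
    rw [hs]
  rw [hs0, zero_add] at hr
  exact ⟨t, ht.trans hT, hr, by simp [State.goto]⟩

/-- An invariant of a repetition. -/
theorem eval_rep_induction {B : Block} (I : ℕ → State → Prop) {m : ℕ} {s : State} (hm : s.ireg 4 = m) (h0 : I 0 s)
    (h8 : ∀ j s v, I j s → I j { s with ireg := Function.update s.ireg 8 v })
    (h4 : ∀ j s v, I j s → I j { s with ireg := Function.update s.ireg 4 v })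
    (hstep : ∀ j < m, ∀ s, I j s → I (j + 1) (evalBlock B s)) : I m ((Phase.rep B).eval s) := by
  have key : ∀ j ≤ m, I j ((evalBlock (repBlock B))^[j] s) := by
    intro j
    induction j with
    | zero => exact fun _ => h0
    | succ j ih =>
      intro hj
      rw [Function.iterate_succ_apply']
      have : ∀ s, evalBlock (repBlock B) s = evalBlock [.op (.iconst 8 1), .op (.isub 4 4 8)]
          (evalBlock B ((Stmt.op (.iconst 8 0)).eval s)) := fun s => by
        rw [← evalBlock_append]
        rfl
      rw [this]
      exact h4 _ _ _ (h8 _ _ _ (hstep j (by omega) _ (h8 _ _ _ (ih (by omega)))))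
  simp only [Phase.eval, hm]
  exact h8 _ _ _ (key m le_rfl)

end RealRAM

namespace LineAgents

open RealRAM

/-! ## The program

Integer registers: `0` number of agents, `1` source, `2` address of the output triples, `3` current
agent, `4` counter, `5` and `6` increment and decrement of the current agent, `7` and `10` addresses,
`8` used by repetitions, `9` the constant one.

Real registers: `0` power, `1` relay value, `2` distance of the current agent, `3` its position, `4`
position of the source, `5` sign of the side, `6` one half, `7` auxiliary, `8` and `9` end points of
movements, `10` zero, `11` and `12` relay values of the right and left side, `13` time, `14` starting
time of the second movement, `15` auxiliary. -/

/-- Initialize the relay value with the distance of the current agent. -/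
def loadAcc : Block := [.op (.rload 3 3), .op (.rsub 1 3 4), .op (.rmul 1 1 5)]

def setupRight : Block :=
  [.op (.rconst 5 1), .op (.isub 3 0 9), .op (.isub 4 3 1), .op (.iconst 5 0),
    .op (.iconst 6 1)] ++ loadAcc

def setupLeft : Block :=
  [.op (.rconst 5 (-1)), .op (.iconst 3 0), .op (.imov 4 1), .op (.iconst 5 1),
    .op (.iconst 6 0)] ++ loadAcc

def initBlock : Block :=
  [.op (.imov 2 0), .op (.iconst 9 1), .op (.rconst 6 (1 / 2)), .op (.rload 4 1)]

/-- Take account of the current agent in the power and in the relay value. -/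
def measureBlock : Block :=
  [.op (.rload 3 3), .op (.rsub 2 3 4), .op (.rmul 2 2 5), .op (.rsub 7 1 2), .op (.rmul 7 7 6),
    .cmov 7 0 0 7, .op (.radd 1 1 2), .op (.rmul 1 1 6), .op (.iadd 3 3 5), .op (.isub 3 3 6)]

/-- Compute the power. -/
def powerBlock : Block :=
  -- Register `7` receives the maximum and register `8` the minimum of the two relay values.
  [.op (.rmov 12 1), .op (.rmov 7 11), .cmov 12 7 7 12, .op (.rmov 8 11), .cmov 8 12 8 12,
    .op (.radd 8 8 8), .op (.radd 8 8 7), .op (.rmul 8 8 6), .op (.rmul 8 8 6), .op (.rmul 7 7 6),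
    .cmov 8 7 7 8, .cmov 7 0 0 7]

/-- Write the two movements of the current agent. -/
def recordBlock : Block :=
  [.op (.iadd 7 3 3), .op (.istore 7 3), .op (.iadd 10 7 9), .op (.istore 10 3),
    -- For agent `i` register `7` takes the values `3 * i`, `6 * i`, `6 * i + n`: two triples per
    -- agent, placed behind the `n` input cells.
    .op (.iadd 7 7 3), .op (.iadd 7 7 7), .op (.iadd 7 7 2),
    .op (.rstore 7 10), .op (.iadd 7 7 9), .op (.rstore 7 3), .op (.iadd 7 7 9),
    .op (.rstore 7 8), .op (.iadd 7 7 9), .op (.rstore 7 14), .op (.iadd 7 7 9),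
    .op (.rstore 7 8), .op (.iadd 7 7 9), .op (.rstore 7 9)]

/-- Compute the movements of the source. -/
def sourceBlock : Block :=
  [.op (.imov 3 1), .op (.rmov 3 4), .op (.rsub 7 11 0), .cmov 10 7 7 10, .op (.radd 7 4 7),
    .op (.rsub 15 12 0), .cmov 10 15 15 10, .op (.rsub 15 4 15), .op (.rmov 8 7),
    .cmov 11 12 8 15, .op (.rmov 9 15), .cmov 11 12 9 7, .op (.rmov 14 13)]

/-- Compute the movements of the current agent. -/
def planBlock : Block :=
  [.op (.rload 3 3), .op (.rsub 2 3 4), .op (.rmul 2 2 5), .op (.rsub 9 1 0), .cmov 10 9 9 10,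
    .op (.radd 1 1 2), .op (.rmul 1 1 6), .op (.rsub 8 1 0), .cmov 10 8 8 10,
    .op (.radd 14 13 8), .op (.rmul 8 8 5), .op (.radd 8 4 8), .op (.rmul 9 9 5),
    .op (.radd 9 4 9)]

def advanceBlock : Block := [.op (.iadd 3 3 5), .op (.isub 3 3 6)]

/-- Each side is scanned twice, because the movements depend on the power, which is known only after
both sides have been measured. Register `13` holds first `D`, the departure time of the source for
its second movement, and then `D + D`. -/
def broadcastPhases : List Phase :=
  [.block initBlock, .block setupRight, .block [.op (.rmov 13 1)], .rep measureBlock,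
    .block [.op (.rmov 11 1)], .block setupLeft, .block [.op (.radd 13 13 1)], .rep measureBlock,
    .block powerBlock, .block sourceBlock, .block recordBlock, .block [.op (.radd 13 13 13)],
    .block setupRight, .rep (planBlock ++ (recordBlock ++ advanceBlock)),
    .block setupLeft, .rep (planBlock ++ (recordBlock ++ advanceBlock)),
    .block [.op (.iadd 0 0 0), .op (.iconst 1 0)]]

/-! ## States of the machine -/

variable {n : ℕ}

/-- What does not change during the run. -/
structure Env (pos : Fin n → ℝ) (k : Fin n) (s : State) : Prop where
  count : s.ireg 0 = n
  source : s.ireg 1 = k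
  base : s.ireg 2 = n
  one : s.ireg 9 = 1
  origin : s.rreg 4 = pos k
  half : s.rreg 6 = 1 / 2
  zero : s.rreg 10 = 0
  mem : ∀ i : Fin n, s.rmem i = pos i

/-- The current agent is the agent number `j` of a side. -/
structure Cursor (pos : Fin n → ℝ) (k : Fin n) (σ : ℝ) (idx : ℕ → Fin n) (up down j : ℕ)
    (s : State) : Prop where
  cur : s.ireg 3 = idx j
  up : s.ireg 5 = up
  down : s.ireg 6 = down
  sign : s.rreg 5 = σ
  acc : s.rreg 1 = relayAcc (sideDist pos k σ idx) j

/-- The movements of agent `i` are in the memory. -/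
structure Recorded (s : State) (n i : ℕ) (p x t y : ℝ) : Prop where
  agent : s.imem (2 * i) = i
  agent' : s.imem (2 * i + 1) = i
  zero : s.rmem (n + 6 * i) = 0
  src : s.rmem (n + 6 * i + 1) = p
  dst : s.rmem (n + 6 * i + 2) = x
  start : s.rmem (n + 6 * i + 3) = t
  src' : s.rmem (n + 6 * i + 4) = x
  dst' : s.rmem (n + 6 * i + 5) = y

variable {pos : Fin n → ℝ} {k : Fin n} {s : State} {σ : ℝ} {idx : ℕ → Fin n} {up down : ℕ}

theorem eval_initBlock (pos : Fin n → ℝ) (k : Fin n) :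
    Env pos k (evalBlock initBlock (inputState pos k)) ∧
      (evalBlock initBlock (inputState pos k)).rreg 0 = 0 := by
  refine ⟨⟨?_, ?_, ?_, ?_, ?_, ?_, ?_, fun i => ?_⟩, ?_⟩ <;>
    simp [initBlock, evalBlock, Stmt.eval, exec, State.setI, State.setR, State.goto, inputState]

theorem eval_setupRight (h : Env pos k s) :
    Env pos k (evalBlock setupRight s) ∧
      Cursor pos k 1 (rightIdx k) 0 1 0 (evalBlock setupRight s) ∧
      (evalBlock setupRight s).ireg 4 = n - 1 - k ∧
      (∀ r, r ≠ 1 → r ≠ 3 → r ≠ 5 → (evalBlock setupRight s).rreg r = s.rreg r) ∧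
      (evalBlock setupRight s).imem = s.imem ∧ (evalBlock setupRight s).rmem = s.rmem := by
  obtain ⟨h1, h2, h3, h4, h5, h6, h7, h8⟩ := h
  have h9 : s.rmem (n - 1) = pos (rightIdx k 0) := h8 (rightIdx k 0)
  refine ⟨⟨?_, ?_, ?_, ?_, ?_, ?_, ?_, fun i => ?_⟩, ⟨?_, ?_, ?_, ?_, ?_⟩, ?_,
    fun r r1 r3 r5 => ?_, ?_, ?_⟩ <;>
    simp [setupRight, loadAcc, evalBlock, Stmt.eval, exec, State.setI, State.setR, State.goto,
      relayAcc, sideDist, *]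
  rfl

theorem eval_setupLeft (h : Env pos k s) :
    Env pos k (evalBlock setupLeft s) ∧
      Cursor pos k (-1) (leftIdx k) 1 0 0 (evalBlock setupLeft s) ∧
      (evalBlock setupLeft s).ireg 4 = k ∧
      (∀ r, r ≠ 1 → r ≠ 3 → r ≠ 5 → (evalBlock setupLeft s).rreg r = s.rreg r) ∧
      (evalBlock setupLeft s).imem = s.imem ∧ (evalBlock setupLeft s).rmem = s.rmem := by
  obtain ⟨h1, h2, h3, h4, h5, h6, h7, h8⟩ := h
  have h0 : ((leftIdx k 0 : Fin n) : ℕ) = 0 := by simp [leftIdx]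
  have h9 : s.rmem 0 = pos (leftIdx k 0) := by rw [← h8 (leftIdx k 0), h0]
  refine ⟨⟨?_, ?_, ?_, ?_, ?_, ?_, ?_, fun i => ?_⟩, ⟨?_, ?_, ?_, ?_, ?_⟩, ?_,
    fun r r1 r3 r5 => ?_, ?_, ?_⟩ <;>
    simp [setupLeft, loadAcc, evalBlock, Stmt.eval, exec, State.setI, State.setR, State.goto,
      relayAcc, sideDist, *]

theorem eval_measureBlock {j : ℕ} (h : Env pos k s) (hc : Cursor pos k σ idx up down j s)
    (hstep : (idx (j + 1) : ℕ) = idx j + up - down) :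
    Env pos k (evalBlock measureBlock s) ∧
      Cursor pos k σ idx up down (j + 1) (evalBlock measureBlock s) ∧
      (evalBlock measureBlock s).rreg 0 = max (s.rreg 0)
        ((relayAcc (sideDist pos k σ idx) j - sideDist pos k σ idx j) / 2) ∧
      (evalBlock measureBlock s).rreg 11 = s.rreg 11 ∧
      (evalBlock measureBlock s).rreg 13 = s.rreg 13 := by
  obtain ⟨h1, h2, h3, h4, h5, h6, h7, h8⟩ := h
  obtain ⟨c1, c2, c3, c4, c5⟩ := hc
  refine ⟨⟨?_, ?_, ?_, ?_, ?_, ?_, ?_, fun i => ?_⟩, ⟨?_, ?_, ?_, ?_, ?_⟩, ?_, ?_, ?_⟩ <;>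
    simp [measureBlock, evalBlock, Stmt.eval, exec, State.setI, State.setR, State.goto,
      relayAcc, sideDist, max_def', div_eq_mul_inv, mul_comm σ, *]

theorem eval_recordBlock (h : Env pos k s) {i : Fin n} (hi : s.ireg 3 = i) :
    Env pos k (evalBlock recordBlock s) ∧
      Recorded (evalBlock recordBlock s) n i (s.rreg 3) (s.rreg 8) (s.rreg 14) (s.rreg 9) ∧
      (evalBlock recordBlock s).rreg = s.rreg ∧
      (∀ r, r ≠ 7 → r ≠ 10 → (evalBlock recordBlock s).ireg r = s.ireg r) ∧
      ∀ (i' : ℕ) p x t y, i' ≠ i → Recorded s n i' p x t y →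
        Recorded (evalBlock recordBlock s) n i' p x t y := by
  obtain ⟨h1, h2, h3, h4, h5, h6, h7, h8⟩ := h
  have hrreg : (evalBlock recordBlock s).rreg = s.rreg := by
    simp [recordBlock, evalBlock, Stmt.eval, exec, State.setI, State.goto]
  have hireg : ∀ r, r ≠ 7 → r ≠ 10 → (evalBlock recordBlock s).ireg r = s.ireg r := by
    intro r r7 r10
    simp [recordBlock, evalBlock, Stmt.eval, exec, State.setI, State.goto, r7, r10]
  have himem : ∀ a, (evalBlock recordBlock s).imem a =
      if a = 2 * i + 1 then (i : ℕ) else if a = 2 * i then (i : ℕ) else s.imem a := by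
    intro a
    simp [recordBlock, evalBlock, Stmt.eval, exec, State.setI, State.goto, h4, hi,
      Function.update_apply, two_mul]
  have hrmem : ∀ a, (evalBlock recordBlock s).rmem a =
      if a = n + 6 * i + 5 then s.rreg 9 else if a = n + 6 * i + 4 then s.rreg 8
      else if a = n + 6 * i + 3 then s.rreg 14 else if a = n + 6 * i + 2 then s.rreg 8
      else if a = n + 6 * i + 1 then s.rreg 3 else if a = n + 6 * i then 0 else s.rmem a := by
    intro a
    have e : (i + (i + (i + (i + (i + (i + n))))) : ℕ) = n + 6 * i := by ring
    simp [recordBlock, evalBlock, Stmt.eval, exec, State.setI, State.goto, h3, h4, h7, hi,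
      Function.update_apply, e, add_assoc]
  -- Different agents occupy disjoint pairs of integer cells and disjoint groups of six real cells.
  have key : ∀ (i' : ℕ) p x t y, i' ≠ i → Recorded s n i' p x t y →
      Recorded (evalBlock recordBlock s) n i' p x t y := by
    rintro i' p x t y hne ⟨m1, m2, m3, m4, m5, m6, m7, m8⟩
    refine ⟨?_, ?_, ?_, ?_, ?_, ?_, ?_, ?_⟩ <;> simp only [himem, hrmem] <;> split_ifs <;>
      omega
  refine ⟨⟨?_, ?_, ?_, ?_, ?_, ?_, ?_, fun i' => ?_⟩, ?_, hrreg, hireg, key⟩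
  · rw [hireg 0 (by decide) (by decide), h1]
  · rw [hireg 1 (by decide) (by decide), h2]
  · rw [hireg 2 (by decide) (by decide), h3]
  · rw [hireg 9 (by decide) (by decide), h4]
  · rw [hrreg, h5]
  · rw [hrreg, h6]
  · rw [hrreg, h7]
  · have := i'.2
    rw [hrmem]
    split_ifs <;> first | omega | exact h8 i'
  · refine ⟨?_, ?_, ?_, ?_, ?_, ?_, ?_, ?_⟩ <;> simp only [himem, hrmem] <;> split_ifs <;>
      first | omega | rfl

theorem Env.of_eq {s' : State} (h : Env pos k s)
    (hi : ∀ r, r ≠ 3 → r ≠ 4 → r ≠ 8 → s'.ireg r = s.ireg r)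
    (hr : ∀ r, r = 4 ∨ r = 6 ∨ r = 10 → s'.rreg r = s.rreg r)
    (hm : s'.rmem = s.rmem) : Env pos k s' := by
  obtain ⟨h1, h2, h3, h4, h5, h6, h7, h8⟩ := h
  refine ⟨?_, ?_, ?_, ?_, ?_, ?_, ?_, fun i => ?_⟩ <;> simp [*]

theorem Recorded.of_eq {s' : State} {i : ℕ} {p x t y : ℝ} (h : Recorded s n i p x t y)
    (hi : s'.imem = s.imem) (hm : s'.rmem = s.rmem) : Recorded s' n i p x t y := by
  obtain ⟨h1, h2, h3, h4, h5, h6, h7, h8⟩ := h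
  refine ⟨?_, ?_, ?_, ?_, ?_, ?_, ?_, ?_⟩ <;> simp only [*]

theorem eval_planBlock {j : ℕ} (h : Env pos k s) (hc : Cursor pos k σ idx up down j s) :
    let P := s.rreg 0
    let q := sideDist pos k σ idx
    let s' := evalBlock planBlock s
    Env pos k s' ∧ s'.ireg = s.ireg ∧ s'.imem = s.imem ∧ s'.rmem = s.rmem ∧
      s'.rreg 0 = s.rreg 0 ∧ s'.rreg 13 = s.rreg 13 ∧ s'.rreg 5 = s.rreg 5 ∧
      s'.rreg 1 = relayAcc q (j + 1) ∧
      s'.rreg 3 = pos (idx j) ∧ s'.rreg 8 = pos k + σ * reach q P (j + 1) ∧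
      s'.rreg 14 = s.rreg 13 + reach q P (j + 1) ∧ s'.rreg 9 = pos k + σ * reach q P j := by
  obtain ⟨h1, h2, h3, h4, h5, h6, h7, h8⟩ := h
  obtain ⟨c1, c2, c3, c4, c5⟩ := hc
  refine ⟨⟨?_, ?_, ?_, ?_, ?_, ?_, ?_, fun i => ?_⟩, ?_, ?_, ?_, ?_, ?_, ?_, ?_, ?_, ?_, ?_,
    ?_⟩ <;>
    simp [planBlock, evalBlock, Stmt.eval, exec, State.setR, State.goto,
      relayAcc, sideDist, reach, max_def', div_eq_mul_inv, mul_comm σ, *]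

theorem eval_advanceBlock {j : ℕ} (hcur : s.ireg 3 = idx j) (hup : s.ireg 5 = up)
    (hdown : s.ireg 6 = down) (hstep : (idx (j + 1) : ℕ) = idx j + up - down) :
    let s' := evalBlock advanceBlock s
    s'.ireg 3 = idx (j + 1) ∧ (∀ r, r ≠ 3 → s'.ireg r = s.ireg r) ∧ s'.rreg = s.rreg ∧
      s'.imem = s.imem ∧ s'.rmem = s.rmem := by
  refine ⟨?_, fun r r3 => ?_, ?_, ?_, ?_⟩ <;>
    simp [advanceBlock, evalBlock, Stmt.eval, exec, State.setI, State.goto, *]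

theorem eval_powerBlock (h : Env pos k s) :
    let s' := evalBlock powerBlock s
    Env pos k s' ∧ s'.rreg 0 = max (s.rreg 0) (sourcePower (s.rreg 11) (s.rreg 1)) ∧
      s'.rreg 11 = s.rreg 11 ∧ s'.rreg 12 = s.rreg 1 ∧ s'.rreg 13 = s.rreg 13 := by
  obtain ⟨h1, h2, h3, h4, h5, h6, h7, h8⟩ := h
  refine ⟨⟨?_, ?_, ?_, ?_, ?_, ?_, ?_, fun i => ?_⟩, ?_, ?_, ?_, ?_⟩
  all_goals simp [powerBlock, evalBlock, Stmt.eval, exec, State.setR, State.goto,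
      -ite_mul, *]
  simp only [← max_def', ← min_def, sourcePower]
  congr 1
  -- The program halves twice where `sourcePower` divides by four; the comparisons agree after this
  -- rescaling.
  rw [max_def' (max (s.rreg 11) (s.rreg 1) / 2)]
  split_ifs <;> first | (exfalso; linarith) | ring

theorem eval_sourceBlock (h : Env pos k s) :
    let s' := evalBlock sourceBlock s
    let P := s.rreg 0
    let c := s.rreg 11
    let b := s.rreg 12
    Env pos k s' ∧ s'.ireg 3 = k ∧ s'.rreg 0 = P ∧ s'.rreg 13 = s.rreg 13 ∧
      s'.rreg 3 = pos k ∧ s'.rreg 14 = s.rreg 13 ∧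
      s'.rreg 8 = (if c ≤ b then pos k + max (c - P) 0 else pos k - max (b - P) 0) ∧
      s'.rreg 9 = (if c ≤ b then pos k - max (b - P) 0 else pos k + max (c - P) 0) := by
  obtain ⟨h1, h2, h3, h4, h5, h6, h7, h8⟩ := h
  refine ⟨⟨?_, ?_, ?_, ?_, ?_, ?_, ?_, fun i => ?_⟩, ?_, ?_, ?_, ?_, ?_, ?_, ?_⟩ <;>
    simp [sourceBlock, evalBlock, Stmt.eval, exec, State.setI, State.setR, State.goto, max_def',
      *]

/-! ## Repetitions -/

theorem ireg_four_measureBlock (s : State) : (evalBlock measureBlock s).ireg 4 = s.ireg 4 := by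
  simp [measureBlock, evalBlock, Stmt.eval, exec, State.setI, State.setR, State.goto]

theorem ireg_four_moveBlock (s : State) :
    (evalBlock (planBlock ++ (recordBlock ++ advanceBlock)) s).ireg 4 = s.ireg 4 := by
  simp [planBlock, recordBlock, advanceBlock, evalBlock, Stmt.eval, exec, State.setI, State.setR,
    State.goto]

theorem Cursor.of_eq {j : ℕ} {s' : State} (h : Cursor pos k σ idx up down j s)
    (hi : ∀ r, r = 3 ∨ r = 5 ∨ r = 6 → s'.ireg r = s.ireg r)
    (hr : ∀ r, r = 1 ∨ r = 5 → s'.rreg r = s.rreg r) : Cursor pos k σ idx up down j s' := by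
  obtain ⟨h1, h2, h3, h4, h5⟩ := h
  refine ⟨?_, ?_, ?_, ?_, ?_⟩ <;> simp [*]

theorem Env.update {r v : ℕ} (h : Env pos k s) (hr : r = 4 ∨ r = 8) :
    Env pos k { s with ireg := Function.update s.ireg r v } :=
  h.of_eq (fun a h3 h4 h8 => Function.update_of_ne (by rcases hr with rfl | rfl <;> assumption) _ _)
    (fun _ _ => rfl) rfl

theorem Cursor.update {j r v : ℕ} (h : Cursor pos k σ idx up down j s) (hr : r = 4 ∨ r = 8) :
    Cursor pos k σ idx up down j { s with ireg := Function.update s.ireg r v } :=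
  h.of_eq (fun a ha => Function.update_of_ne (by omega) _ _) (fun _ _ => rfl)

theorem eval_rep_measureBlock {m : ℕ} (h : Env pos k s)
    (hc : Cursor pos k σ idx up down 0 s) (hm : s.ireg 4 = m)
    (hstep : ∀ j < m, (idx (j + 1) : ℕ) = idx j + up - down) :
    let s' := (Phase.rep measureBlock).eval s
    Env pos k s' ∧ Cursor pos k σ idx up down m s' ∧
      s'.rreg 0 = carryPower (sideDist pos k σ idx) (s.rreg 0) m ∧
      s'.rreg 11 = s.rreg 11 ∧ s'.rreg 13 = s.rreg 13 := by
  refine eval_rep_induction (fun j s' => Env pos k s' ∧ Cursor pos k σ idx up down j s' ∧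
    s'.rreg 0 = carryPower (sideDist pos k σ idx) (s.rreg 0) j ∧
    s'.rreg 11 = s.rreg 11 ∧ s'.rreg 13 = s.rreg 13) hm ⟨h, hc, rfl, rfl, rfl⟩
    ?_ ?_ (fun j hj s' hs' => ?_)
  · rintro j s' v ⟨i1, i2, i3⟩
    exact ⟨i1.update (Or.inr rfl), i2.update (Or.inr rfl), i3⟩
  · rintro j s' v ⟨i1, i2, i3⟩
    exact ⟨i1.update (Or.inl rfl), i2.update (Or.inl rfl), i3⟩
  · obtain ⟨i1, i2, i3, i4, i5⟩ := hs'
    obtain ⟨o1, o2, o3, o4, o5⟩ := eval_measureBlock i1 i2 (hstep j hj)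
    exact ⟨o1, o2, by rw [o3, i3, carryPower], o4.trans i4, o5.trans i5⟩

theorem eval_moveBlock {j : ℕ} (h : Env pos k s) (hc : Cursor pos k σ idx up down j s)
    (hstep : (idx (j + 1) : ℕ) = idx j + up - down) :
    let P := s.rreg 0
    let q := sideDist pos k σ idx
    let s' := evalBlock (planBlock ++ (recordBlock ++ advanceBlock)) s
    Env pos k s' ∧ Cursor pos k σ idx up down (j + 1) s' ∧ s'.rreg 0 = P ∧
      s'.rreg 13 = s.rreg 13 ∧
      Recorded s' n (idx j) (pos (idx j)) (pos k + σ * reach q P (j + 1))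
        (s.rreg 13 + reach q P (j + 1)) (pos k + σ * reach q P j) ∧
      ∀ (i' : ℕ) p x t y, i' ≠ idx j → Recorded s n i' p x t y → Recorded s' n i' p x t y := by
  intro P q s'
  obtain ⟨a1, a2, a3, a4, a5, a6, a7, a8, a9, a10, a11, a12⟩ := eval_planBlock h hc
  set s1 := evalBlock planBlock s with hs1
  obtain ⟨b1, b2, b3, b4, b5⟩ := eval_recordBlock a1 (i := idx j) (by rw [a2, hc.cur])
  set s2 := evalBlock recordBlock s1 with hs2
  have h3 : s2.ireg 3 = idx j := by rw [b4 3 (by decide) (by decide), a2, hc.cur]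
  have h5 : s2.ireg 5 = up := by rw [b4 5 (by decide) (by decide), a2, hc.up]
  have h6 : s2.ireg 6 = down := by rw [b4 6 (by decide) (by decide), a2, hc.down]
  obtain ⟨c1, c2, c3, c4, c5⟩ := eval_advanceBlock h3 h5 h6 hstep
  have hs' : s' = evalBlock advanceBlock s2 := by
    simp only [s', evalBlock_append, ← hs1, ← hs2]
  rw [← hs'] at c1 c2 c3 c4 c5
  refine ⟨b1.of_eq (fun r r3 _ _ => c2 r r3) (fun r _ => by rw [c3]) c5,
    ⟨c1, by rw [c2 5 (by decide), h5], by rw [c2 6 (by decide), h6], by rw [c3, b3, a7, hc.sign],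
      by rw [c3, b3, a8]⟩, by rw [c3, b3, a5], by rw [c3, b3, a6], ?_,
    fun i' p x t y hne hrec => (b5 i' p x t y hne (hrec.of_eq a3 a4)).of_eq c4 c5⟩
  rw [a9, a10, a11, a12] at b2
  exact b2.of_eq c4 c5

theorem eval_rep_moveBlock {m : ℕ} (h : Env pos k s) (hside : IsSide pos k σ m idx)
    (hc : Cursor pos k σ idx up down 0 s) (hm : s.ireg 4 = m)
    (hstep : ∀ j < m, (idx (j + 1) : ℕ) = idx j + up - down) :
    let P := s.rreg 0
    let q := sideDist pos k σ idx
    let s' := (Phase.rep (planBlock ++ (recordBlock ++ advanceBlock))).eval s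
    Env pos k s' ∧ s'.rreg 0 = P ∧ s'.rreg 13 = s.rreg 13 ∧
      (∀ j < m, Recorded s' n (idx j) (pos (idx j)) (pos k + σ * reach q P (j + 1))
        (s.rreg 13 + reach q P (j + 1)) (pos k + σ * reach q P j)) ∧
      ∀ (i' : Fin n) p x t y, (∀ j < m, i' ≠ idx j) → Recorded s n i' p x t y →
        Recorded s' n i' p x t y := by
  intro P q s'
  have key := eval_rep_induction (B := planBlock ++ (recordBlock ++ advanceBlock))
    (fun j s' => Env pos k s' ∧ Cursor pos k σ idx up down j s' ∧
      s'.rreg 0 = P ∧ s'.rreg 13 = s.rreg 13 ∧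
      (∀ j' < j, Recorded s' n (idx j') (pos (idx j')) (pos k + σ * reach q P (j' + 1))
        (s.rreg 13 + reach q P (j' + 1)) (pos k + σ * reach q P j')) ∧
      ∀ (i' : Fin n) p x t y, (∀ j' < j, i' ≠ idx j') → Recorded s n i' p x t y →
        Recorded s' n i' p x t y) hm
    ⟨h, hc, rfl, rfl, fun j' hj' => by omega, fun _ _ _ _ _ _ h => h⟩ ?_ ?_
    (fun j hj s' hs' => ?_)
  · exact ⟨key.1, key.2.2⟩
  · rintro j s' v ⟨i1, i2, i3, i4, i5, i6⟩
    exact ⟨i1.update (Or.inr rfl), i2.update (Or.inr rfl), i3, i4,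
      fun j' hj' => (i5 j' hj').of_eq rfl rfl,
      fun i' p x t y h1 h2 => (i6 i' p x t y h1 h2).of_eq rfl rfl⟩
  · rintro j s' v ⟨i1, i2, i3, i4, i5, i6⟩
    exact ⟨i1.update (Or.inl rfl), i2.update (Or.inl rfl), i3, i4,
      fun j' hj' => (i5 j' hj').of_eq rfl rfl,
      fun i' p x t y h1 h2 => (i6 i' p x t y h1 h2).of_eq rfl rfl⟩
  · obtain ⟨i1, i2, i3, i4, i5, i6⟩ := hs'
    obtain ⟨o1, o2, o3, o4, o5, o6⟩ := eval_moveBlock i1 i2 (hstep j hj)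
    rw [i3, i4] at o5
    refine ⟨o1, o2, o3.trans i3, o4.trans i4, fun j' hj' => ?_, fun i' p x t y h1 h2 => ?_⟩
    · rcases Nat.lt_succ_iff_lt_or_eq.1 hj' with hlt | rfl
      -- Earlier records survive because `idx` is injective on the side.
      · refine o6 _ _ _ _ _ (fun he => ?_) (i5 j' hlt)
        have := hside.injOn (Set.mem_Iic.2 (by omega : j' ≤ m)) (Set.mem_Iic.2 hj.le)
          (Fin.ext he)
        omega
      · exact o5
    · exact o6 _ _ _ _ _ (fun he => h1 j (by omega) (Fin.ext he))
        (i6 i' p x t y (fun j' hj' => h1 j' (by omega)) h2)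

end LineAgents

/-! ### Correctness and running time of the whole program -/

namespace LineAgents

open RealRAM

variable {n : ℕ} {pos : Fin n → ℝ} {k : Fin n} {s : State}

theorem rightIdx_step {j : ℕ} : (rightIdx k (j + 1) : ℕ) = rightIdx k j + 0 - 1 := by
  simp only [rightIdx]
  omega

theorem leftIdx_step {j : ℕ} (hj : j < (k : ℕ)) :
    (leftIdx k (j + 1) : ℕ) = leftIdx k j + 1 - 0 := by
  simp only [leftIdx]
  omega

/-- The effect of an assignment of real registers. -/
theorem eval_rmov (d a : ℕ) (s : State) :
    (evalBlock [.op (.rmov d a)] s).rreg = Function.update s.rreg d (s.rreg a) ∧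
      (evalBlock [.op (.rmov d a)] s).ireg = s.ireg ∧
      (evalBlock [.op (.rmov d a)] s).imem = s.imem ∧
      (evalBlock [.op (.rmov d a)] s).rmem = s.rmem :=
  ⟨rfl, rfl, rfl, rfl⟩

theorem eval_radd (d a b : ℕ) (s : State) :
    (evalBlock [.op (.radd d a b)] s).rreg = Function.update s.rreg d (s.rreg a + s.rreg b) ∧
      (evalBlock [.op (.radd d a b)] s).ireg = s.ireg ∧
      (evalBlock [.op (.radd d a b)] s).imem = s.imem ∧
      (evalBlock [.op (.radd d a b)] s).rmem = s.rmem :=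
  ⟨rfl, rfl, rfl, rfl⟩

theorem broadcastPhases_isStraight : ∀ φ ∈ broadcastPhases, φ.IsStraight := by
  have hmeasure : (Phase.rep measureBlock).IsStraight := ⟨by decide, ireg_four_measureBlock⟩
  have hmove : (Phase.rep (planBlock ++ (recordBlock ++ advanceBlock))).IsStraight :=
    ⟨by decide, ireg_four_moveBlock⟩
  have hblock : ∀ B : Block, B.all Stmt.isStraight = true → (Phase.block B).IsStraight :=
    fun B hB => List.all_eq_true.1 hB
  simp only [broadcastPhases, List.forall_mem_cons]
  refine ⟨hblock _ rfl, hblock _ rfl, hblock _ rfl, hmeasure, hblock _ rfl, hblock _ rfl,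
    hblock _ rfl, hmeasure, hblock _ rfl, hblock _ rfl, hblock _ rfl, hblock _ rfl, hblock _ rfl,
    hmove, hblock _ rfl, hmove, hblock _ rfl, fun φ hφ => absurd hφ List.not_mem_nil⟩

/-- The first half of the program computes the power. -/
theorem eval_measure_phases {s₀ s₁ s₂ s₃ s₄ s₅ s₆ s₇ s₈ s₉ : State}
    (e₀ : s₀ = inputState pos k) (e₁ : s₁ = evalBlock initBlock s₀)
    (e₂ : s₂ = evalBlock setupRight s₁) (e₃ : s₃ = evalBlock [.op (.rmov 13 1)] s₂)
    (e₄ : s₄ = (Phase.rep measureBlock).eval s₃) (e₅ : s₅ = evalBlock [.op (.rmov 11 1)] s₄)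
    (e₆ : s₆ = evalBlock setupLeft s₅) (e₇ : s₇ = evalBlock [.op (.radd 13 13 1)] s₆)
    (e₈ : s₈ = (Phase.rep measureBlock).eval s₇) (e₉ : s₉ = evalBlock powerBlock s₈) :
    let q := sideDist pos k 1 (rightIdx k)
    let q' := sideDist pos k (-1) (leftIdx k)
    s₃.ireg 4 = n - 1 - k ∧ s₇.ireg 4 = k ∧ Env pos k s₉ ∧
      s₉.rreg 0 = broadcastPower q (n - 1 - k) q' k ∧ s₉.rreg 11 = relayAcc q (n - 1 - k) ∧
      s₉.rreg 12 = relayAcc q' k ∧ s₉.rreg 13 = q 0 + q' 0 := by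
  obtain ⟨a1, a2⟩ := eval_initBlock pos k
  rw [← e₀, ← e₁] at a1 a2
  obtain ⟨b1, b2, b3, b4, -, b6⟩ := eval_setupRight a1
  rw [← e₂] at b1 b2 b3 b4 b6
  obtain ⟨c1, c2, -, c4⟩ := eval_rmov 13 1 s₂
  rw [← e₃] at c1 c2 c4
  have hc : ∀ r, r ≠ 13 → s₃.rreg r = s₂.rreg r := fun r hr => by
    rw [c1, Function.update_of_ne hr]
  obtain ⟨d1, d2, d3, -, d5⟩ := eval_rep_measureBlock (s := s₃) (m := n - 1 - k)
    (b1.of_eq (fun r _ _ _ => by rw [c2]) (fun r hr => hc r (by omega)) c4)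
    (b2.of_eq (fun r _ => by rw [c2]) (fun r hr => hc r (by omega)))
    (by rw [c2, b3]) (fun j _ => rightIdx_step)
  rw [← e₄] at d1 d2 d3 d5
  obtain ⟨f1, f2, -, f4⟩ := eval_rmov 11 1 s₄
  rw [← e₅] at f1 f2 f4
  have hf : ∀ r, r ≠ 11 → s₅.rreg r = s₄.rreg r := fun r hr => by
    rw [f1, Function.update_of_ne hr]
  obtain ⟨g1, g2, g3, g4, -, g6⟩ := eval_setupLeft (s := s₅)
    (d1.of_eq (fun r _ _ _ => by rw [f2]) (fun r hr => hf r (by omega)) f4)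
  rw [← e₆] at g1 g2 g3 g4 g6
  obtain ⟨i1, i2, -, i4⟩ := eval_radd 13 13 1 s₆
  rw [← e₇] at i1 i2 i4
  have hi : ∀ r, r ≠ 13 → s₇.rreg r = s₆.rreg r := fun r hr => by
    rw [i1, Function.update_of_ne hr]
  obtain ⟨j1, j2, j3, j4, j5⟩ := eval_rep_measureBlock (s := s₇) (m := k)
    (g1.of_eq (fun r _ _ _ => by rw [i2]) (fun r hr => hi r (by omega)) i4)
    (g2.of_eq (fun r _ => by rw [i2]) (fun r hr => hi r (by omega)))
    (by rw [i2, g3]) (fun j hj => leftIdx_step hj)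
  rw [← e₈] at j1 j2 j3 j4 j5
  obtain ⟨l1, l2, l3, l4, l5⟩ := eval_powerBlock j1
  rw [← e₉] at l1 l2 l3 l4 l5
  have h11 : s₈.rreg 11 = relayAcc (sideDist pos k 1 (rightIdx k)) (n - 1 - k) := by
    rw [j4, hi 11 (by decide), g4 11 (by decide) (by decide) (by decide), f1,
      Function.update_self, d2.acc]
  have h0 : s₇.rreg 0 = carryPower (sideDist pos k 1 (rightIdx k)) 0 (n - 1 - k) := by
    rw [hi 0 (by decide), g4 0 (by decide) (by decide) (by decide), hf 0 (by decide), d3,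
      hc 0 (by decide), b4 0 (by decide) (by decide) (by decide), a2]
  refine ⟨by rw [c2, b3], by rw [i2, g3], l1, ?_, l3.trans h11, l4.trans j2.acc, ?_⟩
  · rw [l2, j3, h0, h11, j2.acc, broadcastPower]
  · rw [l5, j5, i1, Function.update_self, g2.acc,
      g4 13 (by decide) (by decide) (by decide), hf 13 (by decide), d5, c1,
      Function.update_self, b2.acc, relayAcc, relayAcc]

/-- The second half of the program writes the movements. -/
theorem eval_move_phases (hpos : StrictMono pos)
    {s₉ s₁₀ s₁₁ s₁₂ s₁₃ s₁₄ s₁₅ s₁₆ s₁₇ : State} (h : Env pos k s₉)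
    (e₁₀ : s₁₀ = evalBlock sourceBlock s₉) (e₁₁ : s₁₁ = evalBlock recordBlock s₁₀)
    (e₁₂ : s₁₂ = evalBlock [.op (.radd 13 13 13)] s₁₁) (e₁₃ : s₁₃ = evalBlock setupRight s₁₂)
    (e₁₄ : s₁₄ = (Phase.rep (planBlock ++ (recordBlock ++ advanceBlock))).eval s₁₃)
    (e₁₅ : s₁₅ = evalBlock setupLeft s₁₄)
    (e₁₆ : s₁₆ = (Phase.rep (planBlock ++ (recordBlock ++ advanceBlock))).eval s₁₅)
    (e₁₇ : s₁₇ = evalBlock [.op (.iadd 0 0 0), .op (.iconst 1 0)] s₁₆) :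
    let q := sideDist pos k 1 (rightIdx k)
    let q' := sideDist pos k (-1) (leftIdx k)
    let P := s₉.rreg 0
    let c := s₉.rreg 11
    let b := s₉.rreg 12
    let D := s₉.rreg 13
    s₁₃.ireg 4 = n - 1 - k ∧ s₁₅.ireg 4 = k ∧ s₁₇.rreg 0 = P ∧ s₁₇.ireg 0 = 2 * n ∧
      s₁₇.ireg 1 = 0 ∧ s₁₇.ireg 2 = n ∧
      Recorded s₁₇ n k (pos k)
        (if c ≤ b then pos k + max (c - P) 0 else pos k - max (b - P) 0) D
        (if c ≤ b then pos k - max (b - P) 0 else pos k + max (c - P) 0) ∧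
      (∀ j < n - 1 - k, Recorded s₁₇ n (rightIdx k j) (pos (rightIdx k j))
        (pos k + 1 * reach q P (j + 1)) (D + D + reach q P (j + 1)) (pos k + 1 * reach q P j)) ∧
      ∀ j < (k : ℕ), Recorded s₁₇ n (leftIdx k j) (pos (leftIdx k j))
        (pos k + -1 * reach q' P (j + 1)) (D + D + reach q' P (j + 1))
        (pos k + -1 * reach q' P j) := by
  intro q q' P c b D
  have hR := isSide_right (k := k) hpos
  have hL := isSide_left (k := k) hpos
  obtain ⟨a1, a2, a3, a4, a5, a6, a7, a8⟩ := eval_sourceBlock h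
  rw [← e₁₀] at a1 a2 a3 a4 a5 a6 a7 a8
  obtain ⟨b1, b2, b3, -, -⟩ := eval_recordBlock a1 a2
  rw [← e₁₁] at b1 b2 b3
  rw [a5, a6, a7, a8] at b2
  obtain ⟨c1, c2, c3, c4⟩ := eval_radd 13 13 13 s₁₁
  rw [← e₁₂] at c1 c2 c3 c4
  have hc : ∀ r, r ≠ 13 → s₁₂.rreg r = s₁₁.rreg r := fun r hr => by
    rw [c1, Function.update_of_ne hr]
  obtain ⟨d1, d2, d3, d4, d5, d6⟩ := eval_setupRight (s := s₁₂)
    (b1.of_eq (fun r _ _ _ => by rw [c2]) (fun r hr => hc r (by omega)) c4)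
  rw [← e₁₃] at d1 d2 d3 d4 d5 d6
  have hP : s₁₃.rreg 0 = P := by
    rw [d4 0 (by decide) (by decide) (by decide), hc 0 (by decide), b3, a3]
  have hD : s₁₃.rreg 13 = D + D := by
    rw [d4 13 (by decide) (by decide) (by decide), c1, Function.update_self, b3, a4]
  obtain ⟨f1, f2, f3, f4, f5⟩ := eval_rep_moveBlock d1 hR d2 d3 (fun j _ => rightIdx_step)
  rw [← e₁₄] at f1 f2 f3 f4 f5
  obtain ⟨g1, g2, g3, g4, g5, g6⟩ := eval_setupLeft f1
  rw [← e₁₅] at g1 g2 g3 g4 g5 g6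
  have hP' : s₁₅.rreg 0 = P := by
    rw [g4 0 (by decide) (by decide) (by decide), f2, hP]
  have hD' : s₁₅.rreg 13 = D + D := by
    rw [g4 13 (by decide) (by decide) (by decide), f3, hD]
  obtain ⟨i1, i2, i3, i4, i5⟩ := eval_rep_moveBlock g1 hL g2 g3 (fun j hj => leftIdx_step hj)
  rw [← e₁₆] at i1 i2 i3 i4 i5
  rw [hP, hD] at f4
  rw [hP', hD'] at i4
  have hend : s₁₇.rreg = s₁₆.rreg ∧ s₁₇.imem = s₁₆.imem ∧ s₁₇.rmem = s₁₆.rmem ∧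
      s₁₇.ireg 0 = s₁₆.ireg 0 + s₁₆.ireg 0 ∧ s₁₇.ireg 1 = 0 ∧ s₁₇.ireg 2 = s₁₆.ireg 2 := by
    rw [e₁₇]
    refine ⟨rfl, rfl, rfl, ?_, ?_, ?_⟩ <;>
      simp [evalBlock, Stmt.eval, exec, State.setI, State.goto]
  obtain ⟨z1, z2, z3, z4, z5, z6⟩ := hend
  refine ⟨d3, g3, by rw [z1, i2, hP'], by rw [z4, i1.count, two_mul], z5, by rw [z6, i1.base], ?_,
    fun j hj => ?_, fun j hj => (i4 j hj).of_eq z2 z3⟩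
  -- The record of the source is written before both repetitions and survives them, as the source is
  -- not among the agents they treat.
  · exact (i5 k _ _ _ _ (fun j hj => hL.source_ne hj) ((f5 k _ _ _ _ (fun j hj => hR.source_ne hj)
      (b2.of_eq (d5.trans c3) (d6.trans c4))).of_eq g5 g6)).of_eq z2 z3
  · exact (i5 _ _ _ _ _ (fun j' hj' => hR.idx_ne hL hj hj') ((f4 j hj).of_eq g5 g6)).of_eq z2 z3

/-- Recorded movements of all agents are the output of a strategy. -/
theorem outputs_of_recorded {P : ℝ} {u v t : Fin n → ℝ} (h0 : s.rreg 0 = P)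
    (h1 : s.ireg 0 = 2 * n) (h2 : s.ireg 1 = 0) (h3 : s.ireg 2 = n)
    (h : ∀ i : Fin n, Recorded s n i (pos i) (u i) (t i) (v i)) :
    Outputs s P (twoMoveStrategy pos u v t) := by
  refine ⟨h0, by rw [h1, length_twoMoveStrategy], fun j hj => ?_⟩
  have hj' := hj
  rw [length_twoMoveStrategy] at hj'
  rw [h2, h3]
  obtain ⟨i, rfl | rfl⟩ := Nat.even_or_odd' j
  · obtain ⟨r1, r2, r3, r4, r5, r6, r7, r8⟩ := h ⟨i, by omega⟩
    rw [getElem_twoMoveStrategy_even pos u v t ⟨i, by omega⟩ hj,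
      show 3 * (2 * i) = 6 * i by ring, zero_add]
    exact ⟨r1, r3, r4, r5⟩
  · obtain ⟨r1, r2, r3, r4, r5, r6, r7, r8⟩ := h ⟨i, by omega⟩
    rw [getElem_twoMoveStrategy_odd pos u v t ⟨i, by omega⟩ hj,
      show n + 3 * (2 * i + 1) = n + 6 * i + 3 by ring, zero_add]
    exact ⟨r2, r6, r7, r8⟩

/-- The whole program computes the power and writes the movements. -/
theorem eval_broadcastPhases (hpos : StrictMono pos) :
    let q := sideDist pos k 1 (rightIdx k)
    let q' := sideDist pos k (-1) (leftIdx k)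
    let P := broadcastPower q (n - 1 - k) q' k
    let c := relayAcc q (n - 1 - k)
    let b := relayAcc q' k
    let D := q 0 + q' 0
    ∃ s, evalPhases broadcastPhases (inputState pos k) = s ∧
      costPhases broadcastPhases (inputState pos k) ≤ 500 * n ∧
      s.rreg 0 = P ∧ s.ireg 0 = 2 * n ∧ s.ireg 1 = 0 ∧ s.ireg 2 = n ∧
      Recorded s n k (pos k)
        (if c ≤ b then pos k + max (c - P) 0 else pos k - max (b - P) 0) D
        (if c ≤ b then pos k - max (b - P) 0 else pos k + max (c - P) 0) ∧
      (∀ j < n - 1 - k, Recorded s n (rightIdx k j) (pos (rightIdx k j))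
        (pos k + 1 * reach q P (j + 1)) (D + D + reach q P (j + 1)) (pos k + 1 * reach q P j)) ∧
      ∀ j < (k : ℕ), Recorded s n (leftIdx k j) (pos (leftIdx k j))
        (pos k + -1 * reach q' P (j + 1)) (D + D + reach q' P (j + 1))
        (pos k + -1 * reach q' P j) := by
  intro q q' P c b D
  -- The intermediate states are made opaque, so that they are known only through their equations.
  obtain ⟨s₀, e₀⟩ : ∃ s, s = inputState pos k := ⟨_, rfl⟩
  obtain ⟨s₁, e₁⟩ : ∃ s, s = (Phase.block initBlock).eval s₀ := ⟨_, rfl⟩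
  obtain ⟨s₂, e₂⟩ : ∃ s, s = (Phase.block setupRight).eval s₁ := ⟨_, rfl⟩
  obtain ⟨s₃, e₃⟩ : ∃ s, s = (Phase.block [.op (.rmov 13 1)]).eval s₂ := ⟨_, rfl⟩
  obtain ⟨s₄, e₄⟩ : ∃ s, s = (Phase.rep measureBlock).eval s₃ := ⟨_, rfl⟩
  obtain ⟨s₅, e₅⟩ : ∃ s, s = (Phase.block [.op (.rmov 11 1)]).eval s₄ := ⟨_, rfl⟩
  obtain ⟨s₆, e₆⟩ : ∃ s, s = (Phase.block setupLeft).eval s₅ := ⟨_, rfl⟩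
  obtain ⟨s₇, e₇⟩ : ∃ s, s = (Phase.block [.op (.radd 13 13 1)]).eval s₆ := ⟨_, rfl⟩
  obtain ⟨s₈, e₈⟩ : ∃ s, s = (Phase.rep measureBlock).eval s₇ := ⟨_, rfl⟩
  obtain ⟨s₉, e₉⟩ : ∃ s, s = (Phase.block powerBlock).eval s₈ := ⟨_, rfl⟩
  obtain ⟨s₁₀, e₁₀⟩ : ∃ s, s = (Phase.block sourceBlock).eval s₉ := ⟨_, rfl⟩
  obtain ⟨s₁₁, e₁₁⟩ : ∃ s, s = (Phase.block recordBlock).eval s₁₀ := ⟨_, rfl⟩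
  obtain ⟨s₁₂, e₁₂⟩ : ∃ s, s = (Phase.block [.op (.radd 13 13 13)]).eval s₁₁ := ⟨_, rfl⟩
  obtain ⟨s₁₃, e₁₃⟩ : ∃ s, s = (Phase.block setupRight).eval s₁₂ := ⟨_, rfl⟩
  obtain ⟨s₁₄, e₁₄⟩ : ∃ s,
      s = (Phase.rep (planBlock ++ (recordBlock ++ advanceBlock))).eval s₁₃ := ⟨_, rfl⟩
  obtain ⟨s₁₅, e₁₅⟩ : ∃ s, s = (Phase.block setupLeft).eval s₁₄ := ⟨_, rfl⟩
  obtain ⟨s₁₆, e₁₆⟩ : ∃ s,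
      s = (Phase.rep (planBlock ++ (recordBlock ++ advanceBlock))).eval s₁₅ := ⟨_, rfl⟩
  obtain ⟨s₁₇, e₁₇⟩ : ∃ s,
      s = (Phase.block [.op (.iadd 0 0 0), .op (.iconst 1 0)]).eval s₁₆ := ⟨_, rfl⟩
  have heval : evalPhases broadcastPhases s₀ = s₁₇ := by
    simp only [evalPhases, broadcastPhases, List.foldl_cons, List.foldl_nil, ← e₁, ← e₂, ← e₃,
      ← e₄, ← e₅, ← e₆, ← e₇, ← e₈, ← e₉, ← e₁₀, ← e₁₁, ← e₁₂, ← e₁₃, ← e₁₄, ← e₁₅, ← e₁₆, ← e₁₇]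
  -- The factors are `2 * 10 + 7` for measuring and `2 * 34 + 7` for planning, recording and
  -- advancing; `178` is the cost of the blocks and of the four last tests.
  have hcost : costPhases broadcastPhases s₀ =
      27 * s₃.ireg 4 + 27 * s₇.ireg 4 + 75 * s₁₃.ireg 4 + 75 * s₁₅.ireg 4 + 178 := by
    simp only [costPhases, broadcastPhases, ← e₁, ← e₂, ← e₃,
      ← e₄, ← e₅, ← e₆, ← e₇, ← e₈, ← e₉, ← e₁₀, ← e₁₁, ← e₁₂, ← e₁₃, ← e₁₄, ← e₁₅, ← e₁₆]
    simp only [Phase.cost, List.length_append, initBlock, setupRight, setupLeft, loadAcc,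
      measureBlock, powerBlock, sourceBlock, recordBlock, planBlock, advanceBlock,
      List.length_cons, List.length_nil]
    ring
  obtain ⟨t1, t2, henv, rP, rc, rb, rD⟩ :=
    eval_measure_phases e₀ e₁ e₂ e₃ e₄ e₅ e₆ e₇ e₈ e₉
  obtain ⟨t3, t4, w⟩ :=
    eval_move_phases hpos henv e₁₀ e₁₁ e₁₂ e₁₃ e₁₄ e₁₅ e₁₆ e₁₇
  rw [rP, rc, rb, rD] at w
  rw [← e₀, heval, hcost, t1, t2, t3, t4]
  refine ⟨s₁₇, rfl, ?_, w⟩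
  -- The existence of a source gives `1 ≤ n`, so the constant term is absorbed by `500 * n`.
  have := k.2
  omega

end LineAgents

open LineAgents RealRAM in
theorem theorem2 :
    ∃ (p : RealRAM.Program) (C : ℕ),
      ∀ (n : ℕ) (ℓ : ℝ) (pos : Fin n → ℝ), LineAgents.IsConfiguration ℓ pos →
        ∀ k : Fin n, ∃ (s : RealRAM.State) (P : ℝ) (S : LineAgents.Strategy n),
          RealRAM.HaltsWithin p (LineAgents.inputState pos k) (C * n) s ∧
          LineAgents.Outputs s P S ∧
          LineAgents.IsOptimalBroadcastPower ℓ pos k P ∧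
          S.IsBroadcast ℓ pos k ∧
          S.UsesPowerAtMost P := by
  refine ⟨compilePhases 0 broadcastPhases ++ [.halt], 500, fun n ℓ pos hpos k => ?_⟩
  have hR := isSide_right (k := k) hpos.1
  have hL := isSide_left (k := k) hpos.1
  obtain ⟨s, heval, hcost, w1, w2, w3, w4, wk, wR, wL⟩ := eval_broadcastPhases (k := k) hpos.1
  -- Reading the parameters of the strategy off the final memory avoids defining them by cases on
  -- the side of the agent.
  set u : Fin n → ℝ := fun i => s.rmem (n + 6 * i + 2) with hu
  set v : Fin n → ℝ := fun i => s.rmem (n + 6 * i + 5) with hv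
  set t : Fin n → ℝ := fun i => s.rmem (n + 6 * i + 3) with ht
  have hrec : ∀ i : Fin n, Recorded s n i (pos i) (u i) (t i) (v i) := by
    have : ∀ (i : Fin n) x y z, Recorded s n i (pos i) x y z →
        Recorded s n i (pos i) (u i) (t i) (v i) := fun i x y z h => by
      simp only [hu, hv, ht]
      rw [h.dst, h.start, h.dst']
      exact h
    intro i
    rcases hR.exists_idx hL hpos.1.injective i with rfl | ⟨j, hj, rfl⟩ | ⟨j, hj, rfl⟩
    · exact this _ _ _ _ wk
    · exact this _ _ _ _ (wR j hj)
    · exact this _ _ _ _ (wL j hj)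
  obtain ⟨hS, hSP⟩ := twoMoveStrategy_optimal (u := u) (v := v) (s := t) hpos hR hL rfl rfl
    ⟨fun j hj => (wR j hj).dst, fun j hj => (wR j hj).dst', fun j hj => (wR j hj).start⟩
    ⟨fun j hj => (wL j hj).dst, fun j hj => (wL j hj).dst', fun j hj => (wL j hj).start⟩
    ⟨wk.dst, wk.dst', wk.start⟩
  refine ⟨s.goto (compilePhases 0 broadcastPhases).length, _, twoMoveStrategy pos u v t,
    heval ▸ haltsWithin_phases broadcastPhases_isStraight rfl hcost,
    outputs_of_recorded w1 w2 w3 w4 fun i => (hrec i).of_eq rfl rfl,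
    isOptimalBroadcastPower hpos hR hL hS hSP, hS, hSP⟩
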